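/- Let $k$ be an algebraically closed field of characteristic different from $2$, let $g\ge 2$, and let $C: y^2=f_0(x)$ be a hyperelliptic curve of genus $g$ over $k$ (so $f_0$ is separable of degree $2g+1$ or $2g+2$, and $C$ is the smooth complete curve obtained by gluing the affine curves $y^2=f_0(x)$ and $y^2=x^{2g+2}f_0(1/x)$ along $(x,y)\mapsto(1/x,\,y/x^{g+1})$, $x\neq 0$). Let $\iota_C:(x,y)\mapsto(x,-y)$ be the hyperelliptic involution. Let $\ell$ be a positive integer not divisible by the characteristic of $k$, and let $\sigma\in\mathrm{Aut}(C)$ have order $\ell$ in the reduced automorphism group $\mathrm{Aut}(C)/\langle\iota_C\rangle$. For $A=\begin{pmatrix}\alpha&\beta\\ \gamma&\delta\end{pmatrix}\in \mathrm{GL}_2(k)$ and $\lambda\in k^\times$, an isomorphism of hyperelliptic curves of genus $g$ is said to be represented by $(A,\lambda)$ if it is given by $(x,y)\mapsto\left(\frac{\alpha x+\beta}{\gamma x+\delta},\frac{\lambda y}{(\gamma x+\delta)^{g+1}}\right)$. Then there exist a hyperelliptic curve $C': y^2=f(x)$ of genus $g$ and an isomorphism $\rho: C'\to C$ such that the automorphism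 $\rho^{-1}\sigma\rho$ of $C'$ is represented by $(\mathrm{diag}(\mu,1),\mu')\in\mathrm{GL}_2(k)\times k^\times$, where $\mu$ is a primitive $\ell$-th root of unity and $(\mu')^\ell=1$ or $(\mu')^\ell=-1$. Moreover, for all such $C'$, $f$, $\rho$, $\mu$, $\mu'$: if $\deg f=2g+2$, then $\mu'=\pm\mu^{g+1}$; if $\deg f=2g+1$, then $\mu'=\pm\sqrt{\mu^{2g+1}}$ (that is, $\mu'=\pm s$ for some $s\in k^\times$ with $s^2=\mu^{2g+1}$); and $\sigma=\iota_C$ if and only if $(\mu,\mu')=(1,-1)$ and $\ell=1$. -/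

import Mathlib

open Polynomial

/-- The points of the affine plane curve `y ^ 2 = f(x)` over `k`. -/
@[ext]
structure AffineDoubleCover {k : Type*} [Field k] (f : k[X]) where
  x : k
  y : k
  equation : y ^ 2 = f.eval x

namespace AffineDoubleCover

variable {k : Type*} [Field k] {f : k[X]}

/-- The value at a point of a polynomial in two variables (the outer variable is `y`). -/
noncomputable def value (P : AffineDoubleCover f) (h : k[X][X]) : k :=
  h.evalEval P.x P.y

/-- The Zariski topology: it is generated by the sets where a given polynomial does not vanish. -/
instance : TopologicalSpace (AffineDoubleCover f) :=
  TopologicalSpace.generateFrom {U | ∃ h : k[X][X], U = {P | P.value h ≠ 0}}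

/-- Regular functions on a subset `U` of an affine curve: functions which near every point of `U`
are quotients of polynomials. -/
def IsRegularOn (φ : AffineDoubleCover f → k) (U : Set (AffineDoubleCover f)) : Prop :=
  ∀ P ∈ U, ∃ V : Set (AffineDoubleCover f), IsOpen V ∧ P ∈ V ∧ V ⊆ U ∧
    ∃ a b : k[X][X], ∀ Q ∈ V, Q.value b ≠ 0 ∧ φ Q = Q.value a / Q.value b

/-- The map `(x, y) ↦ (x, -y)`. -/
def flip (P : AffineDoubleCover f) : AffineDoubleCover f :=
  ⟨P.x, -P.y, by rw [neg_sq, P.equation]⟩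

@[simp]
theorem flip_flip (P : AffineDoubleCover f) : P.flip.flip = P := by
  ext <;> simp [flip]

theorem value_flip (P : AffineDoubleCover f) (h : k[X][X]) :
    P.flip.value h = P.value (h.comp (-X)) := by
  simp [value, flip, evalEval, eval_comp]

theorem continuous_flip : Continuous (flip : AffineDoubleCover f → AffineDoubleCover f) := by
  refine continuous_generateFrom_iff.2 ?_
  rintro _ ⟨h, rfl⟩
  refine TopologicalSpace.isOpen_generateFrom_of_mem ⟨h.comp (-X), ?_⟩
  ext P
  simp [value_flip]

theorem IsRegularOn.comp_flip {φ : AffineDoubleCover f → k} {U : Set (AffineDoubleCover f)}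
    (hφ : IsRegularOn φ U) : IsRegularOn (φ ∘ flip) (flip ⁻¹' U) := by
  intro P hP
  obtain ⟨V, hV, hPV, hVU, a, b, hab⟩ := hφ P.flip hP
  refine ⟨flip ⁻¹' V, hV.preimage continuous_flip, hPV, Set.preimage_mono hVU,
    a.comp (-X), b.comp (-X), fun Q hQ => ?_⟩
  simpa [value_flip] using hab Q.flip hQ

end AffineDoubleCover

/-- A hyperelliptic curve `y ^ 2 = f(x)` over `k`, where `f` is separable of degree `2 g + 1` or
`2 g + 2`. Its genus is `g` as soon as `2 ≤ g` and the characteristic of `k` is not `2`. -/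
structure HyperellipticCurve (k : Type*) [Field k] (g : ℕ) where
  f : k[X]
  separable : f.Separable
  degree_eq : f.natDegree = 2 * g + 1 ∨ f.natDegree = 2 * g + 2

namespace HyperellipticCurve

variable {k : Type*} [Field k] {g : ℕ}

/-- The polynomial `x ^ (2 g + 2) f(1 / x)` of the chart at infinity. -/
noncomputable def fInf (C : HyperellipticCurve k g) : k[X] :=
  C.f.reflect (2 * g + 2)

/-- The gluing `(x, y) ↦ (1 / x, y / x ^ (g + 1))`, for `x ≠ 0`, of the two affine charts. -/
inductive Glue (C : HyperellipticCurve k g) :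
    AffineDoubleCover C.f ⊕ AffineDoubleCover C.fInf →
    AffineDoubleCover C.f ⊕ AffineDoubleCover C.fInf → Prop
  | mk (P : AffineDoubleCover C.f) (Q : AffineDoubleCover C.fInf) (h0 : P.x ≠ 0)
      (hx : Q.x = 1 / P.x) (hy : Q.y = P.y / P.x ^ (g + 1)) : Glue C (Sum.inl P) (Sum.inr Q)

/-- The points of the curve: the two affine curves `y ^ 2 = f(x)` and
`y ^ 2 = x ^ (2 g + 2) f(1 / x)`, glued together. -/
def Point (C : HyperellipticCurve k g) : Type _ := Quot C.Glue

/-- The Zariski topology of the glued curve: a set is open if its traces on both charts are. -/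
instance (C : HyperellipticCurve k g) : TopologicalSpace C.Point :=
  inferInstanceAs (TopologicalSpace (Quot C.Glue))

/-- The affine chart `y ^ 2 = f(x)`. -/
def chart (C : HyperellipticCurve k g) (P : AffineDoubleCover C.f) : C.Point :=
  Quot.mk _ (Sum.inl P)

/-- The chart at infinity. -/
def chartInf (C : HyperellipticCurve k g) (P : AffineDoubleCover C.fInf) : C.Point :=
  Quot.mk _ (Sum.inr P)

/-- The regular functions on a subset of the curve (the glued structure sheaf). -/
def IsRegularOn (C : HyperellipticCurve k g) (φ : C.Point → k) (U : Set C.Point) : Prop :=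
  AffineDoubleCover.IsRegularOn (φ ∘ C.chart) (C.chart ⁻¹' U) ∧
    AffineDoubleCover.IsRegularOn (φ ∘ C.chartInf) (C.chartInf ⁻¹' U)

/-- Morphisms of curves: Zariski continuous maps which pull back regular functions on open sets
to regular functions. -/
def IsMorphism (C D : HyperellipticCurve k g) (F : C.Point → D.Point) : Prop :=
  Continuous F ∧ ∀ (V : Set D.Point) (φ : D.Point → k), IsOpen V → D.IsRegularOn φ V →
    C.IsRegularOn (φ ∘ F) (F ⁻¹' V)

theorem IsMorphism.comp {C D E : HyperellipticCurve k g} {G : D.Point → E.Point}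
    {F : C.Point → D.Point} (hG : D.IsMorphism E G) (hF : C.IsMorphism D F) :
    C.IsMorphism E (G ∘ F) :=
  ⟨hG.1.comp hF.1, fun V φ hV hφ => hF.2 (G ⁻¹' V) (φ ∘ G) (hV.preimage hG.1) (hG.2 V φ hV hφ)⟩

/-- Isomorphisms of curves: morphisms with an inverse which is a morphism. -/
structure Iso (C D : HyperellipticCurve k g) where
  toEquiv : C.Point ≃ D.Point
  isMorphism : C.IsMorphism D toEquiv
  isMorphism_symm : D.IsMorphism C toEquiv.symm

namespace Iso

variable {C D E : HyperellipticCurve k g}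

theorem ext {σ τ : C.Iso D} (h : σ.toEquiv = τ.toEquiv) : σ = τ := by
  cases σ; cases τ; cases h; rfl

/-- The identity. -/
def refl (C : HyperellipticCurve k g) : C.Iso C where
  toEquiv := Equiv.refl _
  isMorphism := ⟨continuous_id, fun _ _ _ h => h⟩
  isMorphism_symm := ⟨continuous_id, fun _ _ _ h => h⟩

/-- The inverse of an isomorphism. -/
def symm (σ : C.Iso D) : D.Iso C where
  toEquiv := σ.toEquiv.symm
  isMorphism := σ.isMorphism_symm
  isMorphism_symm := σ.isMorphism

/-- The composite "first `σ`, then `τ`". -/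
def trans (σ : C.Iso D) (τ : D.Iso E) : C.Iso E where
  toEquiv := σ.toEquiv.trans τ.toEquiv
  isMorphism := τ.isMorphism.comp σ.isMorphism
  isMorphism_symm := σ.isMorphism_symm.comp τ.isMorphism_symm

end Iso

/-- The automorphism group `Aut(C)`. -/
abbrev Aut (C : HyperellipticCurve k g) := C.Iso C

/-- The group law of `Aut(C)` is composition of maps: `σ * τ` is `τ` followed by `σ`. -/
instance (C : HyperellipticCurve k g) : Group C.Aut where
  mul σ τ := Iso.trans τ σ
  one := Iso.refl C
  inv σ := Iso.symm σ
  mul_assoc _ _ _ := rfl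
  one_mul _ := rfl
  mul_one _ := rfl
  inv_mul_cancel σ := Iso.ext (Equiv.self_trans_symm σ.toEquiv)

/-- The involution `(x, y) ↦ (x, -y)` on points. -/
noncomputable def flip (C : HyperellipticCurve k g) : C.Point → C.Point :=
  Quot.map (Sum.map AffineDoubleCover.flip AffineDoubleCover.flip) (by
    rintro _ _ ⟨P, Q, h0, hx, hy⟩
    exact Glue.mk P.flip Q.flip h0 hx (by simp [AffineDoubleCover.flip, hy, neg_div]))

theorem flip_flip (C : HyperellipticCurve k g) (P : C.Point) : C.flip (C.flip P) = P := by
  rcases P with ⟨P | P⟩ <;> simp [flip, Quot.map] <;> rfl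

theorem isMorphism_flip (C : HyperellipticCurve k g) : C.IsMorphism C C.flip :=
  ⟨continuous_quot_lift _ (continuous_quot_mk.comp
      (AffineDoubleCover.continuous_flip.sumMap AffineDoubleCover.continuous_flip)),
    fun _ _ _ h => ⟨h.1.comp_flip, h.2.comp_flip⟩⟩

/-- The hyperelliptic involution `(x, y) ↦ (x, -y)`. -/
noncomputable def hyperellipticInvolution (C : HyperellipticCurve k g) : C.Aut where
  toEquiv := ⟨C.flip, C.flip, C.flip_flip, C.flip_flip⟩
  isMorphism := C.isMorphism_flip
  isMorphism_symm := C.isMorphism_flip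

/-- The reduced automorphism group, the quotient of `Aut(C)` by the normal subgroup generated by
the hyperelliptic involution. (For a hyperelliptic curve of genus at least `2`, this involution is
central, so that this subgroup has the two elements `1` and the involution.) -/
abbrev ReducedAut (C : HyperellipticCurve k g) : Type _ :=
  C.Aut ⧸ Subgroup.normalClosure {C.hyperellipticInvolution}

/-- `σ` is represented by `(A, lam)` if
`σ(x, y) = ((α x + β) / (γ x + δ), lam y / (γ x + δ) ^ (g + 1))` for `A = (α, β; γ, δ)`,
at all points `(x, y)` of the affine chart where the right side is defined. -/
def IsRepresentedBy {C D : HyperellipticCurve k g} (σ : C.Iso D) (A : GL (Fin 2) k)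
    (lam : kˣ) : Prop :=
  ∀ P : AffineDoubleCover C.f, A 1 0 * P.x + A 1 1 ≠ 0 →
    ∃ Q : AffineDoubleCover D.f, σ.toEquiv (C.chart P) = D.chart Q ∧
      Q.x = (A 0 0 * P.x + A 0 1) / (A 1 0 * P.x + A 1 1) ∧
      Q.y = lam * P.y / (A 1 0 * P.x + A 1 1) ^ (g + 1)

end HyperellipticCurve

/-- The matrix `diag(μ, 1)`. -/
def diagOne {k : Type*} [Field k] (μ : kˣ) : GL (Fin 2) k where
  val := !![(μ : k), 0; 0, 1]
  inv := !![((μ⁻¹ : kˣ) : k), 0; 0, 1]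
  val_inv := by simp [Matrix.one_fin_two]
  inv_val := by simp [Matrix.one_fin_two]

/-! Every isomorphism of these curves has the form `(x, y) ↦ (Ax, λy / (γx + δ)^(g+1))` for a Möbius
map `A`; granted this, the theorem is linear algebra on `2 × 2` matrices.

For the form of an isomorphism `σ`, identities are proved off finitely many points. The function `u
= x ∘ σ` equals `(a + b y) / c` with `a, b, c` in `k[x]`, so it satisfies a quadratic equation over
`k(x)`; pulling back by the inverse, `x` satisfies a quadratic equation over `k(u)`. If `b ≠ 0` the
first equation is irreducible, so its primitive form divides the second and has degree at most 2 in
`x`. Its discriminant then has degree at most 4, but it is `f` times a nonzero square, and `f` has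
degree at least 5. So `b = 0` (`Squarefree.eq_zero_of_eventually_sq_eq`), and the same elimination
with linear equations shows that `u` is Möbius. Squaring `y ∘ σ = (a + b y) / c` and counting
degrees gives the scalar `λ`.

Generic formulas determine the isomorphism: regular functions that agree almost everywhere agree,
and exchanging the charts brings infinity into view (`IsGenericallyRepresentedBy.eq`). Hence the
involution, represented by `(1, -1)`, is central.

To diagonalise `σ`, a fixed point of its Möbius map is moved to infinity by a translation and an
inversion. The matrix is now upper triangular. With distinct eigenvalues there is a second fixed
point, which is translated to 0; with equal ones, `σ^ℓ` acts trivially on `x` and `ℓ ≠ 0` in `k`, so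
the off-diagonal entry vanishes. Finally `f(μx) = μ'² f(x)` gives `μ'² = μ^(deg f)`, whence both the
values of `μ'` and the exact order of `μ`. -/

/-! ### Squarefree polynomials and squares in `k(x)` -/

section Squarefree

variable {k : Type*} [Field k]

/-- After removing the common factor of `d` and `w`, the square of what remains of `d` divides `f`,
so it is a unit. -/
theorem Squarefree.dvd_of_sq_dvd_sq_mul {f d w : k[X]} (hf : Squarefree f)
    (h : d ^ 2 ∣ w ^ 2 * f) : d ∣ w := by
  by_cases hd : d = 0
  · subst hd
    have : w ^ 2 * f = 0 := by simpa using h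
    rcases mul_eq_zero.1 this with h | h
    · simp [pow_eq_zero_iff (two_ne_zero)] at h
      simp [h]
    · exact absurd h hf.ne_zero
  · obtain ⟨a, b, c, hab, rfl, rfl⟩ := UniqueFactorizationMonoid.exists_reduced_factors d hd w
    have hc : c ≠ 0 := left_ne_zero_of_mul hd
    have h1 : a ^ 2 ∣ b ^ 2 * f := by
      rw [mul_pow, mul_pow, mul_assoc] at h
      exact (mul_dvd_mul_iff_left (pow_ne_zero 2 hc)).1 h
    have h2 : a ^ 2 ∣ f := (hab.pow (m := 2) (n := 2)).dvd_of_dvd_mul_left h1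
    have h3 : IsUnit a := hf a (by rwa [← sq])
    exact mul_dvd_mul_left c h3.dvd

/-- A nonconstant squarefree `f` is not a square in `k(x)`; so the norm `a² - b² f` of `a + b√f`
vanishes only at 0. -/
theorem Squarefree.eq_zero_of_sq_eq {f a b : k[X]} (hf : Squarefree f) (hd : 0 < f.natDegree)
    (h : a ^ 2 = b ^ 2 * f) : a = 0 ∧ b = 0 := by
  have hb : b = 0 := by
    by_contra hb
    obtain ⟨s, rfl⟩ : b ∣ a := hf.dvd_of_sq_dvd_sq_mul (by rw [h, mul_assoc]; exact dvd_mul_right _ _)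
    rw [mul_pow] at h
    have h := mul_left_cancel₀ (pow_ne_zero 2 hb) h
    have hs : IsUnit s := hf s (by rw [← h, sq])
    rw [← h, natDegree_pow, natDegree_eq_zero_of_isUnit hs] at hd
    simp at hd
  subst hb
  simpa using h

end Squarefree

/-! ### Polynomial and regular functions on an affine chart -/

namespace AffineDoubleCover

open Filter

variable {k : Type*} [Field k] {f : k[X]}

/-- The relation `y² = f(x)` lowers the degree in `y` to at most one. -/
theorem exists_value_eq (f : k[X]) (h : k[X][X]) :
    ∃ a b : k[X], ∀ P : AffineDoubleCover f, P.value h = a.eval P.x + b.eval P.x * P.y := by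
  induction h using Polynomial.induction_on with
  | C a => exact ⟨a, 0, fun P => by simp [value, evalEval_C]⟩
  | add p q hp hq =>
    obtain ⟨a, b, hab⟩ := hp
    obtain ⟨c, d, hcd⟩ := hq
    refine ⟨a + c, b + d, fun P => ?_⟩
    have h1 := hab P
    have h2 := hcd P
    simp only [value, evalEval_add, eval_add] at *
    rw [h1, h2]; ring
  | monomial n a ih =>
    obtain ⟨c, d, hcd⟩ := ih
    refine ⟨d * f, c, fun P => ?_⟩
    have h1 := hcd P
    simp only [value, pow_succ, ← mul_assoc, evalEval_mul, eval_mul, evalEval_X] at *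
    rw [h1, ← P.equation]; ring

theorem value_mul (P : AffineDoubleCover f) (h h' : k[X][X]) :
    P.value (h * h') = P.value h * P.value h' := evalEval_mul ..

theorem isOpen_value_ne_zero (h : k[X][X]) : IsOpen {P : AffineDoubleCover f | P.value h ≠ 0} :=
  TopologicalSpace.isOpen_generateFrom_of_mem ⟨h, rfl⟩

/-- Nonvanishing loci are stable under intersection, as values multiply; so they form a basis and
not just a subbasis. -/
theorem isOpen_iff {V : Set (AffineDoubleCover f)} :
    IsOpen V ↔ ∀ P ∈ V, ∃ h : k[X][X], P.value h ≠ 0 ∧ ∀ Q, Q.value h ≠ 0 → Q ∈ V := by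
  constructor
  · intro hV
    induction hV with
    | basic s hs =>
      obtain ⟨h, rfl⟩ := hs
      exact fun P hP => ⟨h, hP, fun Q hQ => hQ⟩
    | univ => exact fun P _ => ⟨1, by simp [value], fun _ _ => trivial⟩
    | inter s t _ _ hs ht =>
      intro P hP
      obtain ⟨h, h1, h2⟩ := hs P hP.1
      obtain ⟨h', h1', h2'⟩ := ht P hP.2
      refine ⟨h * h', by rw [value_mul]; exact mul_ne_zero h1 h1', fun Q hQ => ?_⟩
      rw [value_mul] at hQ
      exact ⟨h2 Q (left_ne_zero_of_mul hQ), h2' Q (right_ne_zero_of_mul hQ)⟩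
    | sUnion S _ ih =>
      rintro P ⟨s, hs, hP⟩
      obtain ⟨h, h1, h2⟩ := ih s hs P hP
      exact ⟨h, h1, fun Q hQ => ⟨s, hs, h2 Q hQ⟩⟩
  · intro hV
    rw [isOpen_iff_mem_nhds]
    intro P hP
    obtain ⟨h, h1, h2⟩ := hV P hP
    exact mem_nhds_iff.2 ⟨_, h2, isOpen_value_ne_zero h, h1⟩

theorem isRegularOn_iff {φ : AffineDoubleCover f → k} {U : Set (AffineDoubleCover f)} :
    IsRegularOn φ U ↔ ∀ P ∈ U, ∃ h a b : k[X][X], P.value h ≠ 0 ∧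
      ∀ Q : AffineDoubleCover f, Q.value h ≠ 0 →
        Q ∈ U ∧ Q.value b ≠ 0 ∧ φ Q = Q.value a / Q.value b := by
  constructor
  · intro H P hP
    obtain ⟨V, hV, hPV, hVU, a, b, hab⟩ := H P hP
    obtain ⟨h, h1, h2⟩ := isOpen_iff.1 hV P hPV
    exact ⟨h, a, b, h1, fun Q hQ => ⟨hVU (h2 Q hQ), hab Q (h2 Q hQ)⟩⟩
  · intro H P hP
    obtain ⟨h, a, b, h1, h2⟩ := H P hP
    exact ⟨_, isOpen_value_ne_zero h, h1, fun Q hQ => (h2 Q hQ).1, a, b, fun Q hQ => (h2 Q hQ).2⟩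

theorem finite_setOf_x_eq (c : k) : {P : AffineDoubleCover f | P.x = c}.Finite := by
  have h : Set.InjOn AffineDoubleCover.y {P : AffineDoubleCover f | P.x = c} := by
    intro P hP Q hQ hPQ
    ext
    · exact hP.trans hQ.symm
    · exact hPQ
  refine Set.Finite.of_finite_image ?_ h
  refine ((X ^ 2 - C (f.eval c) : k[X]).rootSet_finite k).subset ?_
  rintro _ ⟨P, hP, rfl⟩
  rw [mem_rootSet]
  refine ⟨(monic_X_pow_sub_C _ two_ne_zero).ne_zero, ?_⟩
  rw [Set.mem_ofPred_eq] at hP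
  simp [P.equation, hP]

theorem eventually_eval_ne_zero {c : k[X]} (hc : c ≠ 0) :
    ∀ᶠ P : AffineDoubleCover f in cofinite, c.eval P.x ≠ 0 := by
  rw [eventually_cofinite]
  refine ((c.rootSet_finite k).biUnion (fun x _ => finite_setOf_x_eq (f := f) x)).subset ?_
  intro P hP
  simp only [Set.mem_iUnion]
  refine ⟨P.x, ?_, rfl⟩
  rw [mem_rootSet]
  exact ⟨hc, by simpa using hP⟩

theorem exists_x_eq [IsAlgClosed k] (f : k[X]) (c : k) : ∃ P : AffineDoubleCover f, P.x = c := by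
  obtain ⟨y, hy⟩ := IsAlgClosed.exists_pow_nat_eq (f.eval c) (n := 2) (by norm_num)
  exact ⟨⟨c, y, hy⟩, rfl⟩

instance [IsAlgClosed k] : Infinite (AffineDoubleCover f) :=
  haveI : Infinite k := IsAlgClosed.instInfinite
  Infinite.of_surjective AffineDoubleCover.x (exists_x_eq f)

section Generic

variable (hf : Squarefree f) (hd : 0 < f.natDegree)
include hf hd

/-- A zero of `a + b y` is a zero of its norm `a² - b² f`, a nonzero polynomial in `x`. -/
theorem eventually_ne_zero {a b : k[X]} (hab : ¬ (a = 0 ∧ b = 0)) :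
    ∀ᶠ P : AffineDoubleCover f in cofinite, a.eval P.x + b.eval P.x * P.y ≠ 0 := by
  have hN : a ^ 2 - b ^ 2 * f ≠ 0 := fun h => hab (hf.eq_zero_of_sq_eq hd (sub_eq_zero.1 h))
  filter_upwards [eventually_eval_ne_zero (f := f) hN] with P hP h
  apply hP
  simp only [eval_sub, eval_mul, eval_pow, ← P.equation]
  linear_combination (a.eval P.x - b.eval P.x * P.y) * h

theorem eq_zero_of_eventually [IsAlgClosed k] {a b : k[X]}
    (h : ∀ᶠ P : AffineDoubleCover f in cofinite, a.eval P.x + b.eval P.x * P.y = 0) :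
    a = 0 ∧ b = 0 := by
  by_contra hab
  obtain ⟨P, h1, h2⟩ := (h.and (eventually_ne_zero hf hd hab)).exists
  exact h2 h1

theorem eventually_value_ne_zero {h : k[X][X]} {P : AffineDoubleCover f} (hP : P.value h ≠ 0) :
    ∀ᶠ Q : AffineDoubleCover f in cofinite, Q.value h ≠ 0 := by
  obtain ⟨a, b, hab⟩ := exists_value_eq f h
  simp only [hab] at *
  apply eventually_ne_zero hf hd
  rintro ⟨rfl, rfl⟩
  simp at hP

theorem value_eq_zero_of_eventually [IsAlgClosed k] {h : k[X][X]}
    (hh : ∀ᶠ Q : AffineDoubleCover f in cofinite, Q.value h = 0) (P : AffineDoubleCover f) :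
    P.value h = 0 := by
  by_contra hP
  obtain ⟨Q, h1, h2⟩ := (hh.and (eventually_value_ne_zero hf hd hP)).exists
  exact h2 h1

/-- A regular function on a nonempty open set has the form `(a(x) + b(x) y) / c(x)` at almost all
points. -/
theorem IsRegularOn.exists_eventually_eq {φ : AffineDoubleCover f → k}
    {U : Set (AffineDoubleCover f)} (hφ : IsRegularOn φ U) (hne : U.Nonempty) :
    ∃ a b c : k[X], c ≠ 0 ∧ ∀ᶠ P : AffineDoubleCover f in cofinite,
      c.eval P.x * φ P = a.eval P.x + b.eval P.x * P.y := by
  obtain ⟨P, hP⟩ := hne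
  obtain ⟨h, a, b, h1, h2⟩ := isRegularOn_iff.1 hφ P hP
  obtain ⟨a₀, a₁, ha⟩ := exists_value_eq f a
  obtain ⟨b₀, b₁, hb⟩ := exists_value_eq f b
  -- Rationalise the denominator: multiply by the conjugate `b₀ - b₁ y`.
  refine ⟨a₀ * b₀ - a₁ * b₁ * f, a₁ * b₀ - a₀ * b₁, b₀ ^ 2 - b₁ ^ 2 * f, fun h0 => ?_, ?_⟩
  · obtain ⟨rfl, rfl⟩ := hf.eq_zero_of_sq_eq hd (sub_eq_zero.1 h0)
    apply (h2 P h1).2.1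
    simp [hb]
  · filter_upwards [eventually_value_ne_zero hf hd h1] with Q hQ
    obtain ⟨-, h3, h4⟩ := h2 Q hQ
    rw [eq_div_iff h3, ha, hb] at h4
    simp only [eval_sub, eval_mul, eval_pow, ← Q.equation]
    linear_combination (b₀.eval Q.x - b₁.eval Q.x * Q.y) * h4

/-- A regular function which agrees almost everywhere with a quotient of polynomials. -/
theorem IsRegularOn.mul_value_eq [IsAlgClosed k] {φ : AffineDoubleCover f → k}
    {U : Set (AffineDoubleCover f)} (hφ : IsRegularOn φ U) {P : AffineDoubleCover f} (hP : P ∈ U)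
    {r s : k[X][X]} (h : ∀ᶠ Q : AffineDoubleCover f in cofinite, Q.value r * φ Q = Q.value s) :
    P.value r * φ P = P.value s := by
  obtain ⟨w, a, b, h1, h2⟩ := isRegularOn_iff.1 hφ P hP
  -- Near `P` the function is `a / b`; cross-multiplied, the two quotients agree almost everywhere,
  -- hence also at `P`.
  have key : P.value (r * a - s * b) = 0 := by
    refine value_eq_zero_of_eventually hf hd ?_ P
    filter_upwards [h, eventually_value_ne_zero hf hd h1] with Q hQ hQ'
    obtain ⟨-, h3, h4⟩ := h2 Q hQ'
    rw [eq_div_iff h3] at h4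
    simp only [value, evalEval_sub, evalEval_mul] at *
    linear_combination -(evalEval Q.x Q.y r) * h4 + (evalEval Q.x Q.y b) * hQ
  obtain ⟨-, h3, h4⟩ := h2 P h1
  rw [h4, ← mul_div_assoc, div_eq_iff h3]
  simpa [value, sub_eq_zero] using key

end Generic

end AffineDoubleCover

/-! ### Elimination: algebraic relations between `x` and `u` -/

section Bivariate

open Filter

variable {k : Type*} [Field k]

theorem Polynomial.natDegree_coeff_swap_le {P : k[X][X]} {n : ℕ} (hP : P.natDegree ≤ n) (i : ℕ) :
    ((Bivariate.swap P).coeff i).natDegree ≤ n := by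
  rw [P.as_sum_range' (n + 1) (by omega), map_sum, finsetSum_coeff]
  refine natDegree_sum_le_of_forall_le _ _ fun j hj => ?_
  rw [Bivariate.swap_monomial, coeff_mul_C, coeff_map]
  refine (natDegree_C_mul_X_pow_le _ _).trans ?_
  have := Finset.mem_range.1 hj
  omega

theorem Polynomial.evalEval_swap (x y : k) (P : k[X][X]) :
    (Bivariate.swap P).evalEval x y = P.evalEval y x := by
  rw [← coe_aevalAeval_eq_evalEval, ← coe_aevalAeval_eq_evalEval, Bivariate.aevalAeval_swap]

theorem Polynomial.exists_eq_C_mul_isPrimitive (N : k[X][X]) :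
    ∃ (d : k[X]) (M : k[X][X]), N = C d * M ∧ M.IsPrimitive := by
  let _ : NormalizedGCDMonoid k[X] := Classical.choice inferInstance
  exact ⟨N.content, N.primPart, N.eq_C_content_mul_primPart, N.isPrimitive_primPart⟩

/-- Two coprime bivariate polynomials have few common zeros; so an irreducible one divides any
polynomial with which it shares many zeros. -/
theorem Polynomial.IsPrimitive.dvd_of_eventually_evalEval_eq_zero {ι : Type*} {l : Filter ι}
    [NeBot l] {x u : ι → k} (hx : ∀ c : k[X], c ≠ 0 → ∀ᶠ i in l, c.eval (x i) ≠ 0)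
    {M P : k[X][X]} (hM : M.IsPrimitive)
    (hirr : Irreducible (M.map (algebraMap k[X] (RatFunc k))))
    (h1 : ∀ᶠ i in l, M.evalEval (x i) (u i) = 0) (h2 : ∀ᶠ i in l, P.evalEval (x i) (u i) = 0) :
    M ∣ P := by
  let _ : NormalizedGCDMonoid k[X] := Classical.choice inferInstance
  refine hM.dvd_of_fraction_map_dvd_fraction_map (K := RatFunc k) ?_
  by_contra hnd
  obtain ⟨s, t, hst⟩ := (hirr.coprime_iff_not_dvd).2 hnd
  obtain ⟨d, hd, hs⟩ := IsLocalization.integerNormalization_spec (nonZeroDivisors k[X]) s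
  obtain ⟨e, he, ht⟩ := IsLocalization.integerNormalization_spec (nonZeroDivisors k[X]) t
  set s' := IsLocalization.integerNormalization (nonZeroDivisors k[X]) s
  set t' := IsLocalization.integerNormalization (nonZeroDivisors k[X]) t
  have hinj : Function.Injective (map (algebraMap k[X] (RatFunc k))) :=
    map_injective _ (IsFractionRing.injective k[X] (RatFunc k))
  -- The Bézout identity over `k(x)` with denominators cleared: at a common zero of `M` and `P`, the
  -- polynomial `d e` in `x` alone must vanish.
  have key : C e * s' * M + C d * t' * P = C (d * e) := by
    apply hinj
    simp only [Polynomial.map_add, Polynomial.map_mul, map_C, hs, ht, Algebra.smul_def, map_mul]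
    simp only [IsScalarTower.algebraMap_apply k[X] (RatFunc k) (RatFunc k)[X], algebraMap_eq]
    linear_combination (C (algebraMap k[X] (RatFunc k) d) * C (algebraMap k[X] (RatFunc k) e)) * hst
  obtain ⟨i, hi1, hi2, hi3⟩ := (h1.and (h2.and (hx (d * e) (mul_ne_zero (nonZeroDivisors.ne_zero hd)
    (nonZeroDivisors.ne_zero he))))).exists
  apply hi3
  have := congrArg (evalEval (x i) (u i)) key
  rw [evalEval_add, evalEval_mul _ _ _ M, evalEval_mul _ _ _ P, hi1, hi2, evalEval_C] at this
  rw [← this]; ring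

/-- `M` is a primitive minimal equation of `u` over `k(x)`. It divides the relation `P`, read with
the two variables exchanged, so its degree in `x` is at most that of `P`. -/
theorem Polynomial.natDegree_coeff_le_of_eventually {ι : Type*} {l : Filter ι}
    [NeBot l] {x u : ι → k} (hx : ∀ c : k[X], c ≠ 0 → ∀ᶠ i in l, c.eval (x i) ≠ 0)
    {d : k[X]} {M P : k[X][X]} (hM : M.IsPrimitive)
    (hirr : Irreducible ((C d * M).map (algebraMap k[X] (RatFunc k)))) (hP : P ≠ 0)
    (h1 : ∀ᶠ i in l, (C d * M).evalEval (x i) (u i) = 0)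
    (h2 : ∀ᶠ i in l, P.evalEval (u i) (x i) = 0) (j : ℕ) :
    (M.coeff j).natDegree ≤ P.natDegree := by
  have hd : d ≠ 0 := by
    rintro rfl
    simp at hirr
  have hdvd : M ∣ Bivariate.swap P := by
    refine hM.dvd_of_eventually_evalEval_eq_zero hx ?_ ?_ (by simpa [evalEval_swap] using h2)
    · rw [Polynomial.map_mul, map_C] at hirr
      refine (irreducible_isUnit_mul (isUnit_C.2 (IsUnit.mk0 _ ?_))).1 hirr
      simpa using hd
    · filter_upwards [h1, hx d hd] with i hi hi'
      rw [evalEval_mul, evalEval_C] at hi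
      exact (mul_eq_zero.1 hi).resolve_left hi'
  have h3 : Bivariate.swap M ∣ P := by
    obtain ⟨N, hN⟩ := hdvd
    refine ⟨Bivariate.swap N, ?_⟩
    rw [← map_mul, ← hN, Bivariate.swap_swap_apply]
  have := natDegree_coeff_swap_le (natDegree_le_of_dvd h3 hP) j
  rwa [Bivariate.swap_swap_apply] at this

/-- A root in `k(x)` of this quadratic would make `b² f` a square there. -/
theorem Squarefree.irreducible_sq_sub {f : k[X]} (hf : Squarefree f) (hd : 0 < f.natDegree)
    {a b c : k[X]} (hb : b ≠ 0) (hc : c ≠ 0) :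
    Irreducible (((C c * X - C a) ^ 2 - C (b ^ 2 * f) : k[X][X]).map
      (algebraMap k[X] (RatFunc k))) := by
  set φ := algebraMap k[X] (RatFunc k)
  have hφ : Function.Injective φ := IsFractionRing.injective k[X] (RatFunc k)
  have hc' : φ c ≠ 0 := by simpa using (map_ne_zero_iff φ hφ).2 hc
  have e : ((C c * X - C a) ^ 2 - C (b ^ 2 * f) : k[X][X]).map φ =
      C (φ c ^ 2) * X ^ 2 + C (- 2 * φ a * φ c) * X + C (φ a ^ 2 - φ (b ^ 2 * f)) := by
    simp only [Polynomial.map_sub, Polynomial.map_pow, Polynomial.map_mul, map_C, map_X]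
    simp only [C_mul, C_pow, C_sub, C_neg, C_ofNat]
    ring
  have hdeg := natDegree_quadratic (b := - 2 * φ a * φ c) (c := φ a ^ 2 - φ (b ^ 2 * f))
    (pow_ne_zero 2 hc')
  refine irreducible_of_degree_le_three_of_not_isRoot ?_ fun z hz => ?_
  · rw [e, hdeg]; decide
  · have h1 : (φ c * z - φ a) ^ 2 = φ (b ^ 2 * f) := by
      simpa [IsRoot, sub_eq_zero] using hz
    obtain ⟨n, m, hm, hz⟩ := IsFractionRing.div_surjective (A := k[X]) (φ c * z - φ a)
    have hm0 : φ m ≠ 0 := (map_ne_zero_iff φ hφ).2 (nonZeroDivisors.ne_zero hm)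
    rw [← hz, div_pow, div_eq_iff (pow_ne_zero 2 hm0), ← map_pow, ← map_pow, ← map_mul] at h1
    have h2 := hf.eq_zero_of_sq_eq (a := n) (b := m * b) hd (by rw [hφ h1]; ring)
    exact mul_ne_zero (nonZeroDivisors.ne_zero hm) hb h2.2

theorem Polynomial.coeff_eq_of_quadratic_eq {R : Type*} [CommRing R] {m₀ m₁ m₂ d : R} {M : R[X]}
    (h : C m₂ * X ^ 2 + C m₁ * X + C m₀ = C d * M) :
    m₀ = d * M.coeff 0 ∧ m₁ = d * M.coeff 1 ∧ m₂ = d * M.coeff 2 := by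
  simp only [← coeff_C_mul, ← h]
  simp [coeff_X, coeff_C]

/-- Both sides are the discriminant of `(cX - a)² - b² f`, computed directly and after factoring out
`d`. -/
theorem discrim_mul_sq {R : Type*} [CommRing R] {a b c d f m₀ m₁ m₂ : R}
    (e0 : a ^ 2 - b ^ 2 * f = d * m₀) (e1 : - 2 * a * c = d * m₁) (e2 : c ^ 2 = d * m₂) :
    (2 * (b * c)) ^ 2 * f = d ^ 2 * (m₁ ^ 2 - 4 * m₂ * m₀) := by
  linear_combination (d * m₁ - 2 * a * c) * e1 - 4 * d * m₀ * e2 - 4 * c ^ 2 * e0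

/-- Since `f` is squarefree, `d` divides `2bc`; cancelling `d²` leaves the discriminant of the
reduced quadratic as a nonzero square times `f`. -/
theorem Squarefree.natDegree_le_natDegree_discrim {k : Type*} [Field k] (h2 : (2 : k) ≠ 0)
    {f : k[X]} (hf : Squarefree f) {a b c d m₀ m₁ m₂ : k[X]} (hb : b ≠ 0) (hc : c ≠ 0)
    (e0 : a ^ 2 - b ^ 2 * f = d * m₀) (e1 : - 2 * a * c = d * m₁) (e2 : c ^ 2 = d * m₂) :
    f.natDegree ≤ (m₁ ^ 2 - 4 * m₂ * m₀).natDegree := by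
  have hd0 : d ≠ 0 := by
    intro h
    rw [h, zero_mul] at e2
    exact pow_ne_zero 2 hc e2
  have key := discrim_mul_sq e0 e1 e2
  obtain ⟨w, hw⟩ := hf.dvd_of_sq_dvd_sq_mul ⟨_, key⟩
  have h3 : (2 : k[X]) ≠ 0 := by
    rw [← C_ofNat]
    exact C_ne_zero.2 h2
  have hw0 : w ≠ 0 := by
    intro h
    rw [h, mul_zero] at hw
    exact mul_ne_zero h3 (mul_ne_zero hb hc) hw
  rw [hw, mul_pow, mul_assoc] at key
  rw [← mul_left_cancel₀ (pow_ne_zero 2 hd0) key, natDegree_mul (pow_ne_zero 2 hw0) hf.ne_zero]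
  exact Nat.le_add_left _ _

/-- If `u = (a + b √f) / c` generates a field over which `x` has degree at most two, then
`b = 0`, as `f` has degree at least five. -/
theorem Squarefree.eq_zero_of_eventually_sq_eq {ι : Type*} {l : Filter ι} [NeBot l] {x u : ι → k}
    (hx : ∀ c : k[X], c ≠ 0 → ∀ᶠ i in l, c.eval (x i) ≠ 0) (h2 : (2 : k) ≠ 0)
    {f : k[X]} (hf : Squarefree f) (hd : 5 ≤ f.natDegree) {a b c p q r : k[X]} (hc : c ≠ 0)
    (hr : r ≠ 0)
    (h : ∀ᶠ i in l, (c.eval (x i) * u i - a.eval (x i)) ^ 2 = (b ^ 2 * f).eval (x i))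
    (h' : ∀ᶠ i in l, (r.eval (u i) * x i - p.eval (u i)) ^ 2 = q.eval (u i)) : b = 0 := by
  by_contra hb
  have hirr := hf.irreducible_sq_sub (a := a) (by omega) hb hc
  obtain ⟨d, M, hN, hM⟩ := exists_eq_C_mul_isPrimitive ((C c * X - C a) ^ 2 - C (b ^ 2 * f))
  have eP : ((C r * X - C p) ^ 2 - C q : k[X][X]) =
      C (r ^ 2) * X ^ 2 + C (- 2 * p * r) * X + C (p ^ 2 - q) := by
    simp only [C_mul, C_pow, C_sub, C_neg, C_ofNat]
    ring
  have hPdeg : ((C r * X - C p) ^ 2 - C q : k[X][X]).natDegree = 2 := by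
    rw [eP]
    exact natDegree_quadratic (pow_ne_zero 2 hr)
  have hdeg : ∀ j, (M.coeff j).natDegree ≤ 2 := by
    intro j
    rw [← hPdeg]
    rw [hN] at hirr
    refine natDegree_coeff_le_of_eventually (u := u) hx hM hirr ?_ ?_ ?_ j
    · intro h0
      simp [h0] at hPdeg
    · rw [← hN]
      filter_upwards [h] with i hi
      simp only [evalEval_sub, evalEval_mul, evalEval_pow, evalEval_C, evalEval_X]
      rw [hi, sub_self]
    · filter_upwards [h'] with i hi
      simp only [evalEval_sub, evalEval_mul, evalEval_pow, evalEval_C, evalEval_X]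
      rw [hi, sub_self]
  have eN : ((C c * X - C a) ^ 2 - C (b ^ 2 * f) : k[X][X]) =
      C (c ^ 2) * X ^ 2 + C (- 2 * a * c) * X + C (a ^ 2 - b ^ 2 * f) := by
    simp only [C_mul, C_pow, C_sub, C_neg, C_ofNat]
    ring
  obtain ⟨e0, e1, e2⟩ := coeff_eq_of_quadratic_eq (eN.symm.trans hN)
  -- Here `g ≥ 2` enters: degree at most 2 in `x` bounds the discriminant by 4, below the degree of
  -- `f`.
  have l1 : (M.coeff 1 ^ 2 - 4 * M.coeff 2 * M.coeff 0).natDegree ≤ 4 :=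
    natDegree_sub_le_of_le (natDegree_pow_le_of_le 2 (hdeg 1))
      (natDegree_mul_le_of_le (natDegree_mul_le_of_le (natDegree_ofNat 4).le (hdeg 2)) (hdeg 0))
  have := hf.natDegree_le_natDegree_discrim h2 hb hc e0 e1 e2
  omega

/-- A rational function with a rational inverse is a Möbius function. -/
theorem Polynomial.exists_moebius {ι : Type*} {l : Filter ι} [NeBot l] {x u : ι → k}
    (hx : ∀ c : k[X], c ≠ 0 → ∀ᶠ i in l, c.eval (x i) ≠ 0)
    {a c p r : k[X]} (hc : c ≠ 0) (hr : r ≠ 0)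
    (h : ∀ᶠ i in l, c.eval (x i) * u i = a.eval (x i))
    (h' : ∀ᶠ i in l, r.eval (u i) * x i = p.eval (u i)) :
    ∃ α β γ δ : k, ¬ (γ = 0 ∧ δ = 0) ∧ ∀ᶠ i in l, (γ * x i + δ) * u i = α * x i + β := by
  obtain ⟨d, M, hN, hM⟩ := exists_eq_C_mul_isPrimitive (C c * X - C a)
  have hdeg : ∀ j, (M.coeff j).natDegree ≤ 1 := by
    have hPdeg : (C r * X + C (-p)).natDegree = 1 := natDegree_linear hr
    intro j
    rw [← hPdeg]
    refine natDegree_coeff_le_of_eventually (u := u) hx hM (d := d) ?_ ?_ ?_ ?_ j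
    · rw [← hN]
      have hc' : algebraMap k[X] (RatFunc k) c ≠ 0 := by
        simpa using hc
      apply irreducible_of_degree_eq_one
      rw [Polynomial.map_sub, Polynomial.map_mul, map_C, map_C, map_X, sub_eq_add_neg, ← C_neg]
      exact degree_linear hc'
    · intro h0
      rw [h0] at hPdeg
      simp at hPdeg
    · rw [← hN]
      filter_upwards [h] with i hi
      simp only [evalEval_sub, evalEval_mul, evalEval_C, evalEval_X]
      rw [hi, sub_self]
    · filter_upwards [h'] with i hi
      simp only [evalEval_add, evalEval_mul, evalEval_C, evalEval_X, eval_neg]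
      rw [hi, add_neg_cancel]
  have e1 : c = d * M.coeff 1 := by
    have := congrArg (fun p => p.coeff 1) hN
    simp only [coeff_sub, coeff_C_mul, coeff_X, coeff_C] at this
    simpa using this
  have e0 : - a = d * M.coeff 0 := by
    have := congrArg (fun p => p.coeff 0) hN
    simp only [coeff_sub, coeff_C_mul, coeff_X, coeff_C] at this
    simpa using this
  have hd0 : d ≠ 0 := left_ne_zero_of_mul (e1 ▸ hc)
  obtain ⟨γ, δ, h1⟩ := exists_eq_X_add_C_of_natDegree_le_one (hdeg 1)
  obtain ⟨α, β, h0⟩ := exists_eq_X_add_C_of_natDegree_le_one (hdeg 0)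
  -- The relation reads `(γx + δ)u + (αx + β) = 0`, whence the signs.
  refine ⟨-α, -β, γ, δ, ?_, ?_⟩
  · rintro ⟨rfl, rfl⟩
    apply hc
    rw [e1, h1]
    simp
  · filter_upwards [h, hx d hd0] with i hi hi'
    apply mul_left_cancel₀ hi'
    have e1' := congrArg (eval (x i)) e1
    have e0' := congrArg (eval (x i)) e0
    simp only [h1, h0, eval_neg, eval_mul, eval_add, eval_C, eval_X] at e1' e0'
    linear_combination hi - u i * e1' - e0'

end Bivariate

/-- The numerator of `f ((α x + β) / (γ x + δ))`. -/
theorem Polynomial.exists_moebius_numerator {k : Type*} [Field k] {f : k[X]} {N : ℕ}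
    (hf : f.natDegree ≤ N) (α β γ δ : k) :
    ∃ G : k[X], G.natDegree ≤ N ∧ ∀ x u : k, u * (γ * x + δ) = α * x + β →
      (γ * x + δ) ^ N * f.eval u = G.eval x := by
  refine ⟨∑ i ∈ Finset.range (N + 1), C (f.coeff i) *
    ((C α * X + C β) ^ i * (C γ * X + C δ) ^ (N - i)), ?_, fun x u hu => ?_⟩
  · refine natDegree_sum_le_of_forall_le _ _ fun i hi => ?_
    have hi := Finset.mem_range.1 hi
    refine (natDegree_C_mul_le _ _).trans ?_
    refine (natDegree_mul_le_of_le (natDegree_pow_le_of_le i natDegree_linear_le)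
      (natDegree_pow_le_of_le (N - i) natDegree_linear_le)).trans ?_
    omega
  · rw [eval_finsetSum, eval_eq_sum_range' (Nat.lt_succ_of_le hf), Finset.mul_sum]
    refine Finset.sum_congr rfl fun i hi => ?_
    have hi := Finset.mem_range.1 hi
    simp only [eval_mul, eval_C, eval_pow, eval_add, eval_X]
    rw [← hu, mul_pow, show N = i + (N - i) by omega, pow_add, Nat.add_sub_cancel_left]
    ring

/-! ### Charts and coordinates on the glued curve -/

namespace HyperellipticCurve

open Filter

variable {k : Type*} [Field k] {g : ℕ}

theorem five_le_natDegree (hg : 2 ≤ g) (C : HyperellipticCurve k g) : 5 ≤ C.f.natDegree := by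
  rcases C.degree_eq with h | h <;> omega

theorem natDegree_pos (C : HyperellipticCurve k g) : 0 < C.f.natDegree := by
  rcases C.degree_eq with h | h <;> omega

theorem natDegree_le (C : HyperellipticCurve k g) : C.f.natDegree ≤ 2 * g + 2 := by
  rcases C.degree_eq with h | h <;> omega

theorem eval_fInf (C : HyperellipticCurve k g) {u : k} (hu : u ≠ 0) :
    C.fInf.eval u = u ^ (2 * g + 2) * C.f.eval u⁻¹ := by
  let _ := invertibleOfNonzero (inv_ne_zero hu)
  have := eval₂_reflect_mul_pow (RingHom.id k) u⁻¹ (2 * g + 2) C.f C.natDegree_le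
  rw [invOf_eq_inv, inv_inv] at this
  rw [eval, eval, ← this, fInf, inv_pow, mul_comm _ (_ * _), mul_assoc,
    inv_mul_cancel₀ (pow_ne_zero _ hu), mul_one]

/-- The affine coordinates of a point, where they are defined. -/
noncomputable def affineCoord (C : HyperellipticCurve k g) : C.Point → Option (k × k) :=
  open Classical in
  Quot.lift (Sum.elim (fun P => some (P.x, P.y))
    (fun Q => if Q.x = 0 then none else some (1 / Q.x, Q.y / Q.x ^ (g + 1)))) (by
    rintro _ _ ⟨P, Q, h0, hx, hy⟩
    have h1 : P.x ^ (g + 1) ≠ 0 := pow_ne_zero _ h0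
    simp [hx, hy, h0])

@[simp]
theorem affineCoord_chart (C : HyperellipticCurve k g) (P : AffineDoubleCover C.f) :
    C.affineCoord (C.chart P) = some (P.x, P.y) := rfl

theorem affineCoord_chartInf (C : HyperellipticCurve k g) {Q : AffineDoubleCover C.fInf}
    (hQ : Q.x ≠ 0) : C.affineCoord (C.chartInf Q) = some (1 / Q.x, Q.y / Q.x ^ (g + 1)) :=
  if_neg hQ

theorem affineCoord_chartInf_of_eq_zero (C : HyperellipticCurve k g)
    {Q : AffineDoubleCover C.fInf} (hQ : Q.x = 0) : C.affineCoord (C.chartInf Q) = none :=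
  if_pos hQ

theorem chart_injective (C : HyperellipticCurve k g) : Function.Injective C.chart := by
  intro P Q h
  have := congrArg C.affineCoord h
  simp only [affineCoord_chart, Option.some.injEq, Prod.mk.injEq] at this
  exact AffineDoubleCover.ext this.1 this.2

theorem chartInf_eq_chart (C : HyperellipticCurve k g) {P : AffineDoubleCover C.f}
    {Q : AffineDoubleCover C.fInf} (hP : P.x ≠ 0) (hx : Q.x = 1 / P.x)
    (hy : Q.y = P.y / P.x ^ (g + 1)) : C.chartInf Q = C.chart P :=
  (Quot.sound (Glue.mk P Q hP hx hy)).symm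

theorem exists_chart_eq_chartInf (C : HyperellipticCurve k g) {Q : AffineDoubleCover C.fInf}
    (hQ : Q.x ≠ 0) : ∃ P : AffineDoubleCover C.f, C.chart P = C.chartInf Q ∧ P.x = 1 / Q.x ∧
      P.y = Q.y / Q.x ^ (g + 1) := by
  refine ⟨⟨1 / Q.x, Q.y / Q.x ^ (g + 1), ?_⟩, ?_, rfl, rfl⟩
  · rw [div_pow, Q.equation, C.eval_fInf hQ, ← pow_mul, show (g + 1) * 2 = 2 * g + 2 by ring,
      mul_div_cancel_left₀ _ (pow_ne_zero _ hQ), one_div]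
  · symm
    apply C.chartInf_eq_chart
    · simpa using hQ
    · simp
    · simp [hQ]

theorem exists_chart_or (C : HyperellipticCurve k g) (p : C.Point) :
    (∃ P, p = C.chart P) ∨ ∃ Q : AffineDoubleCover C.fInf, Q.x = 0 ∧ p = C.chartInf Q := by
  rcases p with ⟨P | Q⟩
  · exact Or.inl ⟨P, rfl⟩
  · by_cases hQ : Q.x = 0
    · exact Or.inr ⟨Q, hQ, rfl⟩
    · obtain ⟨P, hP, -⟩ := C.exists_chart_eq_chartInf hQ
      exact Or.inl ⟨P, hP.symm⟩

theorem chartInf_mem_range_chart_iff (C : HyperellipticCurve k g) (Q : AffineDoubleCover C.fInf) :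
    C.chartInf Q ∈ Set.range C.chart ↔ Q.x ≠ 0 := by
  constructor
  · rintro ⟨P, hP⟩ hQ
    have := congrArg C.affineCoord hP
    rw [C.affineCoord_chartInf_of_eq_zero hQ] at this
    simp at this
  · intro hQ
    obtain ⟨P, hP, -⟩ := C.exists_chart_eq_chartInf hQ
    exact ⟨P, hP⟩

theorem isOpen_iff (C : HyperellipticCurve k g) {V : Set C.Point} :
    IsOpen V ↔ IsOpen (C.chart ⁻¹' V) ∧ IsOpen (C.chartInf ⁻¹' V) :=
  isOpen_coinduced.trans isOpen_sum_iff

theorem preimage_chartInf_range_chart (C : HyperellipticCurve k g) :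
    C.chartInf ⁻¹' Set.range C.chart = {Q | Q.value (Polynomial.C X) ≠ 0} := by
  ext Q
  simp only [Set.mem_preimage, chartInf_mem_range_chart_iff]
  simp [AffineDoubleCover.value, evalEval_C]

theorem isOpen_range_chart (C : HyperellipticCurve k g) : IsOpen (Set.range C.chart) := by
  rw [isOpen_iff, preimage_chartInf_range_chart]
  refine ⟨?_, AffineDoubleCover.isOpen_value_ne_zero _⟩
  rw [Set.preimage_range]
  exact isOpen_univ

theorem finite_compl_range_chart (C : HyperellipticCurve k g) : (Set.range C.chart)ᶜ.Finite := by
  refine ((AffineDoubleCover.finite_setOf_x_eq (f := C.fInf) 0).image C.chartInf).subset ?_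
  intro p hp
  rcases C.exists_chart_or p with ⟨P, rfl⟩ | ⟨Q, hQ, rfl⟩
  · exact absurd ⟨P, rfl⟩ hp
  · exact ⟨Q, hQ, rfl⟩

/-- The coordinate function `x`, extended by `0` to the points at infinity. -/
noncomputable def xCoord (C : HyperellipticCurve k g) (p : C.Point) : k :=
  ((C.affineCoord p).getD 0).1

/-- The coordinate function `y`, extended by `0` to the points at infinity. -/
noncomputable def yCoord (C : HyperellipticCurve k g) (p : C.Point) : k :=
  ((C.affineCoord p).getD 0).2

@[simp]
theorem xCoord_chart (C : HyperellipticCurve k g) (P : AffineDoubleCover C.f) :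
    C.xCoord (C.chart P) = P.x := rfl

@[simp]
theorem yCoord_chart (C : HyperellipticCurve k g) (P : AffineDoubleCover C.f) :
    C.yCoord (C.chart P) = P.y := rfl

theorem isRegularOn_xCoord (C : HyperellipticCurve k g) :
    C.IsRegularOn C.xCoord (Set.range C.chart) := by
  constructor
  · rw [Set.preimage_range]
    exact fun P _ => ⟨Set.univ, isOpen_univ, trivial, le_rfl, Polynomial.C X, 1,
      fun Q _ => by simp [AffineDoubleCover.value, evalEval_C]⟩
  · rw [preimage_chartInf_range_chart]
    refine fun P hP => ⟨_, AffineDoubleCover.isOpen_value_ne_zero _, hP, le_rfl, 1,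
      Polynomial.C X, fun Q hQ => ⟨hQ, ?_⟩⟩
    have hQ : Q.x ≠ 0 := by simpa [AffineDoubleCover.value, evalEval_C] using hQ
    simp [xCoord, affineCoord_chartInf, hQ, AffineDoubleCover.value, evalEval_C]

theorem isRegularOn_yCoord (C : HyperellipticCurve k g) :
    C.IsRegularOn C.yCoord (Set.range C.chart) := by
  constructor
  · rw [Set.preimage_range]
    exact fun P _ => ⟨Set.univ, isOpen_univ, trivial, le_rfl, X, 1,
      fun Q _ => by simp [AffineDoubleCover.value]⟩
  · rw [preimage_chartInf_range_chart]
    refine fun P hP => ⟨_, AffineDoubleCover.isOpen_value_ne_zero _, hP, le_rfl, X,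
      Polynomial.C (X ^ (g + 1)), fun Q hQ => ?_⟩
    have hQ : Q.x ≠ 0 := by simpa [AffineDoubleCover.value, evalEval_C] using hQ
    simp [yCoord, affineCoord_chartInf, hQ, AffineDoubleCover.value, evalEval_C]

theorem eventually_point (C : HyperellipticCurve k g) {p : AffineDoubleCover C.f → Prop}
    (h : ∀ᶠ P in cofinite, p P) : ∀ᶠ q in cofinite, ∃ P, q = C.chart P ∧ p P := by
  rw [eventually_cofinite] at *
  refine ((h.image C.chart).union C.finite_compl_range_chart).subset ?_
  intro q hq
  by_cases hq' : q ∈ Set.range C.chart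
  · obtain ⟨P, rfl⟩ := hq'
    exact Or.inl ⟨P, fun hP => hq ⟨P, rfl, hP⟩, rfl⟩
  · exact Or.inr hq'

theorem eventually_chart (C : HyperellipticCurve k g) {p : C.Point → Prop}
    (h : ∀ᶠ q in cofinite, p q) : ∀ᶠ P in cofinite, p (C.chart P) :=
  C.chart_injective.tendsto_cofinite.eventually h

theorem Iso.eventually {C D : HyperellipticCurve k g} (σ : C.Iso D) {p : D.Point → Prop}
    (h : ∀ᶠ q in cofinite, p q) : ∀ᶠ q in cofinite, p (σ.toEquiv q) :=
  σ.toEquiv.injective.tendsto_cofinite.eventually h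

theorem Iso.eventually_exists_chart {C D : HyperellipticCurve k g} (σ : C.Iso D)
    {p : AffineDoubleCover D.f → Prop} (h : ∀ᶠ Q in cofinite, p Q) :
    ∀ᶠ P in cofinite, ∃ Q, σ.toEquiv (C.chart P) = D.chart Q ∧ p Q :=
  C.eventually_chart (σ.eventually (D.eventually_point h))

theorem _root_.AffineDoubleCover.eventually_flip {f : k[X]} {p : AffineDoubleCover f → Prop}
    (h : ∀ᶠ P in cofinite, p P) : ∀ᶠ P : AffineDoubleCover f in cofinite, p P.flip :=
  (Function.LeftInverse.injective AffineDoubleCover.flip_flip).tendsto_cofinite.eventually h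

theorem eventually_y_ne_zero (C : HyperellipticCurve k g) :
    ∀ᶠ P : AffineDoubleCover C.f in cofinite, P.y ≠ 0 := by
  have := AffineDoubleCover.eventually_ne_zero C.separable.squarefree C.natDegree_pos
    (a := 0) (b := 1) (by simp)
  simpa using this

/-- The formula `σ(x, y) = ((α x + β) / (γ x + δ), lam y / (γ x + δ) ^ (g + 1))` holds at almost
all points. -/
def IsGenericallyRepresentedBy {C D : HyperellipticCurve k g} (σ : C.Iso D)
    (A : Matrix (Fin 2) (Fin 2) k) (lam : k) : Prop :=
  ∀ᶠ P : AffineDoubleCover C.f in cofinite, A 1 0 * P.x + A 1 1 ≠ 0 ∧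
    ∃ Q : AffineDoubleCover D.f, σ.toEquiv (C.chart P) = D.chart Q ∧
      Q.x * (A 1 0 * P.x + A 1 1) = A 0 0 * P.x + A 0 1 ∧
      Q.y * (A 1 0 * P.x + A 1 1) ^ (g + 1) = lam * P.y

/-! ### Isomorphisms are Möbius maps on `x` and scale `y` -/

variable [IsAlgClosed k]

theorem Iso.exists_eventually_eq {C D : HyperellipticCurve k g} (σ : C.Iso D) {φ : D.Point → k}
    (hφ : D.IsRegularOn φ (Set.range D.chart)) :
    ∃ a b c : k[X], c ≠ 0 ∧ ∀ᶠ P : AffineDoubleCover C.f in cofinite,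
      c.eval P.x * φ (σ.toEquiv (C.chart P)) = a.eval P.x + b.eval P.x * P.y := by
  have h := (σ.isMorphism.2 _ _ D.isOpen_range_chart hφ).1
  refine h.exists_eventually_eq C.separable.squarefree C.natDegree_pos ?_
  obtain ⟨P, Q, hQ, -⟩ := (σ.eventually_exists_chart (p := fun _ => True) (by simp)).exists
  exact ⟨P, Q, hQ.symm⟩

/-- An isomorphism maps `x` to a function of `x`. -/
theorem Iso.exists_eventually_xCoord_eq (h2 : (2 : k) ≠ 0) (hg : 2 ≤ g)
    {C D : HyperellipticCurve k g} (σ : C.Iso D) :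
    ∃ a c : k[X], c ≠ 0 ∧ ∀ᶠ P : AffineDoubleCover C.f in cofinite,
      c.eval P.x * D.xCoord (σ.toEquiv (C.chart P)) = a.eval P.x := by
  obtain ⟨a, b, c, hc, h⟩ := σ.exists_eventually_eq D.isRegularOn_xCoord
  obtain ⟨p, q, r, hr, h'⟩ := σ.symm.exists_eventually_eq C.isRegularOn_xCoord
  have hb : b = 0 := by
    -- The inverse gives `r(u)x - p(u) = q(u)y'`, with `y'` the second coordinate on `D`; squaring
    -- replaces `y'²` by `D.f(u)`.
    refine C.separable.squarefree.eq_zero_of_eventually_sq_eq (l := cofinite)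
      (x := AffineDoubleCover.x (f := C.f)) (u := fun P => D.xCoord (σ.toEquiv (C.chart P)))
      (fun c hc => AffineDoubleCover.eventually_eval_ne_zero hc) h2 (C.five_le_natDegree hg)
      (a := a) (b := b) (p := p) (q := q ^ 2 * D.f) hc hr ?_ ?_
    · filter_upwards [h] with P hP
      rw [hP, eval_mul, eval_pow, ← P.equation]
      ring
    · filter_upwards [σ.eventually_exists_chart h'] with P hP
      obtain ⟨Q, hQ, h3⟩ := hP
      rw [← hQ, show σ.symm.toEquiv (σ.toEquiv (C.chart P)) = C.chart P from
        σ.toEquiv.symm_apply_apply _] at h3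
      rw [hQ, xCoord_chart, ← xCoord_chart C P, h3, eval_mul, eval_pow, ← Q.equation]
      ring
  exact ⟨a, c, hc, by simpa [hb] using h⟩

/-- An isomorphism of hyperelliptic curves is given by a Möbius transformation. -/
theorem Iso.exists_moebius (h2 : (2 : k) ≠ 0) (hg : 2 ≤ g)
    {C D : HyperellipticCurve k g} (σ : C.Iso D) :
    ∃ A : Matrix (Fin 2) (Fin 2) k, A.det ≠ 0 ∧
      ∀ᶠ P : AffineDoubleCover C.f in cofinite, A 1 0 * P.x + A 1 1 ≠ 0 ∧
        D.xCoord (σ.toEquiv (C.chart P)) * (A 1 0 * P.x + A 1 1) = A 0 0 * P.x + A 0 1 := by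
  obtain ⟨a, c, hc, h⟩ := σ.exists_eventually_xCoord_eq h2 hg
  obtain ⟨p, r, hr, h'⟩ := σ.symm.exists_eventually_xCoord_eq h2 hg
  obtain ⟨α, β, γ, δ, h0, h1⟩ := Polynomial.exists_moebius (l := cofinite)
    (x := AffineDoubleCover.x (f := C.f)) (u := fun P => D.xCoord (σ.toEquiv (C.chart P)))
    (fun c hc => AffineDoubleCover.eventually_eval_ne_zero hc) hc hr h (by
      filter_upwards [σ.eventually_exists_chart h'] with P hP
      obtain ⟨Q, hQ, h3⟩ := hP
      rw [← hQ, show σ.symm.toEquiv (σ.toEquiv (C.chart P)) = C.chart P from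
        σ.toEquiv.symm_apply_apply _] at h3
      rwa [hQ, xCoord_chart, ← xCoord_chart C P])
  have hne : ∀ᶠ P : AffineDoubleCover C.f in cofinite, γ * P.x + δ ≠ 0 := by
    have : Polynomial.C γ * X + Polynomial.C δ ≠ 0 := by
      intro h
      apply h0
      have h3 := congrArg (fun p => p.coeff 1) h
      have h4 := congrArg (fun p => p.coeff 0) h
      exact ⟨by simpa [coeff_C] using h3, by simpa using h4⟩
    filter_upwards [AffineDoubleCover.eventually_eval_ne_zero this] with P hP
    simpa using hP
  refine ⟨!![α, β; γ, δ], ?_, ?_⟩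
  · rw [Matrix.det_fin_two_of]
    intro hdet
    -- A singular matrix would make `x ∘ σ` generically a constant `t`, but only finitely many
    -- points of `D` lie over `t`.
    obtain ⟨t, ht1, ht2⟩ : ∃ t, α = t * γ ∧ β = t * δ := by
      by_cases hδ : δ = 0
      · have hγ : γ ≠ 0 := fun h => h0 ⟨h, hδ⟩
        refine ⟨α / γ, by field_simp, ?_⟩
        have : β * γ = 0 := by rw [hδ] at hdet; linear_combination -hdet
        rw [hδ, mul_zero]
        exact (mul_eq_zero.1 this).resolve_right hγ
      · refine ⟨β / δ, ?_, by field_simp⟩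
        field_simp
        linear_combination hdet
    have h5 := σ.eventually_exists_chart
      (AffineDoubleCover.eventually_eval_ne_zero (f := D.f) (X_sub_C_ne_zero t))
    obtain ⟨P, h6, h7, Q, hQ, h8⟩ := (h1.and (hne.and h5)).exists
    rw [hQ, xCoord_chart, ht1, ht2] at h6
    apply h8
    rw [eval_sub, eval_X, eval_C, sub_eq_zero]
    apply mul_left_cancel₀ h7
    linear_combination h6
  · filter_upwards [h1, hne] with P h3 h4
    refine ⟨by simpa using h4, ?_⟩
    simp
    linear_combination h3

/-- Every isomorphism of hyperelliptic curves is generically represented by a matrix and a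
scalar. -/
theorem Iso.exists_isGenericallyRepresentedBy (h2 : (2 : k) ≠ 0) (hg : 2 ≤ g)
    {C D : HyperellipticCurve k g} (σ : C.Iso D) :
    ∃ (A : Matrix (Fin 2) (Fin 2) k) (lam : k), A.det ≠ 0 ∧ lam ≠ 0 ∧
      IsGenericallyRepresentedBy σ A lam := by
  obtain ⟨A, hA, h⟩ := σ.exists_moebius h2 hg
  obtain ⟨a, b, c, hc, h'⟩ := σ.exists_eventually_eq D.isRegularOn_yCoord
  have haff := σ.eventually_exists_chart (p := fun _ => True) (by simp)
  obtain ⟨G, hG, hGe⟩ := exists_moebius_numerator D.natDegree_le (A 0 0) (A 0 1) (A 1 0) (A 1 1)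
  set L : k[X] := Polynomial.C (A 1 0) * X + Polynomial.C (A 1 1) with hL
  have hLe : ∀ x, L.eval x = A 1 0 * x + A 1 1 := by simp [hL]
  have hsq := C.separable.squarefree
  have hL0 : L ≠ 0 := by
    intro h0
    obtain ⟨P, hP, -⟩ := h.exists
    rw [← hLe, h0] at hP
    simp at hP
  have hM0 : L ^ (g + 1) ≠ 0 := pow_ne_zero _ hL0
  -- Substitute `(a + b y) / c` into the equation of `D` and separate the parts without and with
  -- `y`.
  have key : (L ^ (g + 1)) ^ 2 * (a ^ 2 + b ^ 2 * C.f) - c ^ 2 * G = 0 ∧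
      2 * (L ^ (g + 1)) ^ 2 * (a * b) = 0 := by
    refine AffineDoubleCover.eq_zero_of_eventually hsq C.natDegree_pos ?_
    filter_upwards [h, h', haff] with P hP hP' hQ
    obtain ⟨Q, hQ, -⟩ := hQ
    rw [hQ, xCoord_chart] at hP
    rw [hQ, yCoord_chart] at hP'
    have e := hGe P.x Q.x hP.2
    rw [← Q.equation, ← hLe, show 2 * g + 2 = (g + 1) * 2 by ring, pow_mul] at e
    simp only [eval_sub, eval_mul, eval_pow, eval_add, eval_ofNat, ← P.equation, ← e]
    linear_combination -((L.eval P.x) ^ (g + 1)) ^ 2 *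
      (c.eval P.x * Q.y + a.eval P.x + b.eval P.x * P.y) * hP'
  have h2' : (2 : k[X]) ≠ 0 := by
    rw [← C_ofNat]
    exact C_ne_zero.2 h2
  -- Otherwise `σ` would send a generic `P` and its flip to the same point.
  have hb : b ≠ 0 := by
    intro hb
    have h3 : ∀ᶠ P : AffineDoubleCover C.f in cofinite,
        ∀ Q, σ.toEquiv (C.chart P) = D.chart Q → A 1 0 * P.x + A 1 1 ≠ 0 ∧ c.eval P.x ≠ 0 ∧
          Q.x * (A 1 0 * P.x + A 1 1) = A 0 0 * P.x + A 0 1 ∧ c.eval P.x * Q.y = a.eval P.x := by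
      filter_upwards [h, h', AffineDoubleCover.eventually_eval_ne_zero hc] with P hP hP' h4 Q hQ
      rw [hQ, xCoord_chart] at hP
      rw [hQ, yCoord_chart] at hP'
      exact ⟨hP.1, h4, hP.2, by simpa [hb] using hP'⟩
    obtain ⟨P, h4, h5, h6, ⟨Q, hQ, -⟩, ⟨Q', hQ', -⟩⟩ := (C.eventually_y_ne_zero.and (h3.and
      ((AffineDoubleCover.eventually_flip h3).and
        (haff.and (AffineDoubleCover.eventually_flip haff))))).exists
    obtain ⟨n1, n2, h7, h8⟩ := h5 Q hQ
    obtain ⟨-, -, h9, h10⟩ := h6 Q' hQ'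
    have hQQ : Q = Q' := by
      ext
      · exact mul_right_cancel₀ n1 (h7.trans h9.symm)
      · exact mul_left_cancel₀ n2 (h8.trans h10.symm)
    rw [← hQQ, ← hQ] at hQ'
    have h11 := congrArg AffineDoubleCover.y (C.chart_injective (σ.toEquiv.injective hQ'))
    have h12 : -P.y = P.y := h11
    have : 2 * P.y = 0 := by linear_combination -h12
    exact (mul_ne_zero h2 h4) this
  have ha : a = 0 := by
    have h3 := (mul_eq_zero.1 key.2).resolve_left (mul_ne_zero h2' (pow_ne_zero 2 hM0))
    exact (mul_eq_zero.1 h3).resolve_right hb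
  have e1 : (L ^ (g + 1) * b) ^ 2 * C.f = c ^ 2 * G := by
    rw [ha] at key
    linear_combination key.1
  -- The quotient `w` satisfies `w² f = G`; as `deg G ≤ 2g + 2` and `deg f ≥ 2g + 1`, it is
  -- constant, and it is the scalar sought.
  obtain ⟨w, hw⟩ := hsq.dvd_of_sq_dvd_sq_mul ⟨_, e1⟩
  have hw0 : w ≠ 0 := by
    intro h0
    rw [h0, mul_zero] at hw
    exact mul_ne_zero hM0 hb hw
  rw [hw, mul_pow, mul_assoc] at e1
  have e2 := mul_left_cancel₀ (pow_ne_zero 2 hc) e1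
  rw [← e2, natDegree_mul (pow_ne_zero 2 hw0) hsq.ne_zero, natDegree_pow] at hG
  have hwd : w.natDegree = 0 := by
    rcases C.degree_eq with h | h <;> omega
  obtain ⟨lam, rfl⟩ := natDegree_eq_zero.1 hwd
  refine ⟨A, lam, hA, by simpa using hw0, ?_⟩
  filter_upwards [h, h', haff, AffineDoubleCover.eventually_eval_ne_zero hc] with P hP hP' hQ hP''
  obtain ⟨Q, hQ, -⟩ := hQ
  rw [hQ, xCoord_chart] at hP
  rw [hQ, yCoord_chart] at hP'
  refine ⟨hP.1, Q, hQ, hP.2, ?_⟩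
  apply mul_left_cancel₀ hP''
  have e3 := congrArg (eval P.x) hw
  simp only [eval_mul, eval_pow, hLe, eval_C] at e3
  rw [ha] at hP'
  simp only [eval_zero, zero_add] at hP'
  linear_combination (A 1 0 * P.x + A 1 1) ^ (g + 1) * hP' + P.y * e3

end HyperellipticCurve

/-! ### Maps given locally by fractions are morphisms -/

namespace AffineDoubleCover

variable {k : Type*} [Field k]

/-- Clearing denominators in the value of a polynomial at a point with coordinates
`a₁ / b` and `a₂ / b`. -/
theorem exists_value_eq_pow_mul {f₁ f₂ : k[X]} (a₁ a₂ b h : k[X][X]) :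
    ∃ (n : ℕ) (H : k[X][X]), ∀ (P : AffineDoubleCover f₁) (Q : AffineDoubleCover f₂),
      Q.x * P.value b = P.value a₁ → Q.y * P.value b = P.value a₂ →
      P.value H = P.value b ^ n * Q.value h := by
  set p : k[X][X] → Prop := fun h => ∃ (n : ℕ) (H : k[X][X]), ∀ (P : AffineDoubleCover f₁)
    (Q : AffineDoubleCover f₂), Q.x * P.value b = P.value a₁ → Q.y * P.value b = P.value a₂ →
      P.value H = P.value b ^ n * Q.value h
  have hadd : ∀ h h', p h → p h' → p (h + h') := by
    rintro h h' ⟨n, H, hH⟩ ⟨n', H', hH'⟩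
    refine ⟨n + n', H * b ^ n' + H' * b ^ n, fun P Q hx hy => ?_⟩
    have h1 := hH P Q hx hy
    have h2 := hH' P Q hx hy
    simp only [value, evalEval_add, evalEval_mul, evalEval_pow] at *
    rw [h1, h2]
    ring
  have hmul : ∀ h h', p h → p h' → p (h * h') := by
    rintro h h' ⟨n, H, hH⟩ ⟨n', H', hH'⟩
    refine ⟨n + n', H * H', fun P Q hx hy => ?_⟩
    rw [value_mul, value_mul, hH P Q hx hy, hH' P Q hx hy]
    ring
  have hx : p (C X) := ⟨1, a₁, fun P Q hx _ => by
    rw [← hx, pow_one, mul_comm, value, value, evalEval_C, eval_X]⟩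
  have hy : p X := ⟨1, a₂, fun P Q _ hy => by
    rw [← hy, pow_one, mul_comm, value, value, evalEval_X]⟩
  change p h
  induction h using Polynomial.induction_on with
  | C a =>
    induction a using Polynomial.induction_on with
    | C r => exact ⟨0, C (C r), fun P Q _ _ => by simp [value, evalEval_C]⟩
    | add q r hq hr => rw [C_add]; exact hadd _ _ hq hr
    | monomial n r ih => rw [pow_succ, ← mul_assoc, C_mul]; exact hmul _ _ ih hx
  | add q r hq hr => exact hadd _ _ hq hr
  | monomial n r ih => rw [pow_succ, ← mul_assoc]; exact hmul _ _ ih hy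

/-- Near the point `P`, the map `e` is given by quotients of polynomials in the chart `c`. -/
def IsRationalNear {f₁ f₂ : k[X]} {X : Type*} (c : AffineDoubleCover f₂ → X)
    (e : AffineDoubleCover f₁ → X) (P : AffineDoubleCover f₁) : Prop :=
  ∃ h a₁ a₂ b : k[X][X], P.value h ≠ 0 ∧ ∀ P' : AffineDoubleCover f₁, P'.value h ≠ 0 →
    P'.value b ≠ 0 ∧ ∃ Q : AffineDoubleCover f₂, e P' = c Q ∧ Q.x * P'.value b = P'.value a₁ ∧
      Q.y * P'.value b = P'.value a₂

section

variable {f₁ f₂ : k[X]} {X : Type*} {c : AffineDoubleCover f₂ → X} {e : AffineDoubleCover f₁ → X}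
  {P : AffineDoubleCover f₁}

theorem IsRationalNear.exists_of_isOpen (h : IsRationalNear c e P) {V : Set X}
    (hV : IsOpen (c ⁻¹' V)) (hP : e P ∈ V) :
    ∃ h : k[X][X], P.value h ≠ 0 ∧ ∀ P', P'.value h ≠ 0 → e P' ∈ V := by
  obtain ⟨h, a₁, a₂, b, h1, h2⟩ := h
  obtain ⟨hb, Q, hQ, hx, hy⟩ := h2 P h1
  obtain ⟨w, hw1, hw2⟩ := isOpen_iff.1 hV Q (by rwa [Set.mem_preimage, ← hQ])
  obtain ⟨n, H, hH⟩ := exists_value_eq_pow_mul (f₁ := f₁) (f₂ := f₂) a₁ a₂ b w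
  refine ⟨h * H, ?_, fun P' hP' => ?_⟩
  · rw [value_mul, hH P Q hx hy]
    exact mul_ne_zero h1 (mul_ne_zero (pow_ne_zero _ hb) hw1)
  · rw [value_mul] at hP'
    obtain ⟨hb', Q', hQ', hx', hy'⟩ := h2 P' (left_ne_zero_of_mul hP')
    rw [hH P' Q' hx' hy'] at hP'
    rw [hQ']
    exact hw2 Q' (right_ne_zero_of_mul (right_ne_zero_of_mul hP'))

theorem IsRationalNear.exists_of_isRegularOn (h : IsRationalNear c e P) {V : Set X} {φ : X → k}
    (hφ : IsRegularOn (φ ∘ c) (c ⁻¹' V)) (hP : e P ∈ V) :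
    ∃ h a b : k[X][X], P.value h ≠ 0 ∧ ∀ P' : AffineDoubleCover f₁, P'.value h ≠ 0 →
        P' ∈ e ⁻¹' V ∧ P'.value b ≠ 0 ∧ (φ ∘ e) P' = P'.value a / P'.value b := by
  obtain ⟨h, a₁, a₂, b, h1, h2⟩ := h
  obtain ⟨hb, Q, hQ, hx, hy⟩ := h2 P h1
  obtain ⟨w, r, s, hw1, hw2⟩ := isRegularOn_iff.1 hφ Q (by rwa [Set.mem_preimage, ← hQ])
  obtain ⟨n, H, hH⟩ := exists_value_eq_pow_mul (f₁ := f₁) (f₂ := f₂) a₁ a₂ b w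
  obtain ⟨nr, R, hR⟩ := exists_value_eq_pow_mul (f₁ := f₁) (f₂ := f₂) a₁ a₂ b r
  obtain ⟨ns, S, hS⟩ := exists_value_eq_pow_mul (f₁ := f₁) (f₂ := f₂) a₁ a₂ b s
  refine ⟨h * H, R * b ^ ns, S * b ^ nr, ?_, fun P' hP' => ?_⟩
  · rw [value_mul, hH P Q hx hy]
    exact mul_ne_zero h1 (mul_ne_zero (pow_ne_zero _ hb) hw1)
  · rw [value_mul] at hP'
    obtain ⟨hb', Q', hQ', hx', hy'⟩ := h2 P' (left_ne_zero_of_mul hP')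
    rw [hH P' Q' hx' hy'] at hP'
    obtain ⟨h3, h4, h5⟩ := hw2 Q' (right_ne_zero_of_mul (right_ne_zero_of_mul hP'))
    have hpow : ∀ n : ℕ, P'.value (b ^ n) = P'.value b ^ n := fun n => evalEval_pow ..
    rw [value_mul, value_mul, hR P' Q' hx' hy', hS P' Q' hx' hy', hpow, hpow]
    refine ⟨by rwa [Set.mem_preimage, hQ'], mul_ne_zero (mul_ne_zero (pow_ne_zero _ hb') h4)
      (pow_ne_zero _ hb'), ?_⟩
    rw [Function.comp_apply, hQ']
    refine h5.trans ?_
    have := pow_ne_zero nr hb'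
    have := pow_ne_zero ns hb'
    field_simp

end

end AffineDoubleCover

namespace HyperellipticCurve

open Filter AffineDoubleCover

variable {k : Type*} [Field k] {g : ℕ}

/-- Openness and regularity are local, so explicit fractions in the charts suffice; translations and
inversions are treated this way. -/
theorem isMorphism_of_isRationalNear {C D : HyperellipticCurve k g} {F : C.Point → D.Point}
    (h : ∀ P, IsRationalNear D.chart (F ∘ C.chart) P ∨ IsRationalNear D.chartInf (F ∘ C.chart) P)
    (h' : ∀ P, IsRationalNear D.chart (F ∘ C.chartInf) P ∨
      IsRationalNear D.chartInf (F ∘ C.chartInf) P) : C.IsMorphism D F := by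
  refine ⟨continuous_def.2 fun V hV => ?_, fun V φ hV hφ => ⟨?_, ?_⟩⟩
  · rw [D.isOpen_iff] at hV
    rw [C.isOpen_iff]
    refine ⟨AffineDoubleCover.isOpen_iff.2 fun P hP => ?_,
      AffineDoubleCover.isOpen_iff.2 fun P hP => ?_⟩
    · exact (h P).elim (fun H => H.exists_of_isOpen hV.1 hP) (fun H => H.exists_of_isOpen hV.2 hP)
    · exact (h' P).elim (fun H => H.exists_of_isOpen hV.1 hP)
        (fun H => H.exists_of_isOpen hV.2 hP)
  · exact isRegularOn_iff.2 fun P hP => (h P).elim (fun H => H.exists_of_isRegularOn hφ.1 hP)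
      (fun H => H.exists_of_isRegularOn hφ.2 hP)
  · exact isRegularOn_iff.2 fun P hP => (h' P).elim (fun H => H.exists_of_isRegularOn hφ.1 hP)
      (fun H => H.exists_of_isRegularOn hφ.2 hP)

/-! ### Calculus of generic representations -/

/-- The factor `γx + δ` is a cocycle: its value for `B * A` at `x` is the product of that for `B` at
`Ax` and that for `A` at `x`. -/
theorem IsGenericallyRepresentedBy.trans {C D E : HyperellipticCurve k g} {σ : C.Iso D}
    {τ : D.Iso E} {A B : Matrix (Fin 2) (Fin 2) k} {l m : k} (hσ : IsGenericallyRepresentedBy σ A l)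
    (hτ : IsGenericallyRepresentedBy τ B m) :
    IsGenericallyRepresentedBy (σ.trans τ) (B * A) (m * l) := by
  filter_upwards [hσ, σ.eventually_exists_chart hτ] with P h1 h2
  obtain ⟨h1, Q, hQ, hx, hy⟩ := h1
  obtain ⟨Q', hQ', h2, R, hR, hx', hy'⟩ := h2
  obtain rfl := D.chart_injective (hQ.symm.trans hQ')
  have e : (B * A) 1 0 * P.x + (B * A) 1 1 = (B 1 0 * Q.x + B 1 1) * (A 1 0 * P.x + A 1 1) := by
    simp only [Matrix.mul_apply, Fin.sum_univ_two]
    linear_combination -(B 1 0) * hx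
  refine ⟨by rw [e]; exact mul_ne_zero h2 h1, R, ?_, ?_, ?_⟩
  · rw [← hR, ← hQ]
    rfl
  · rw [e]
    simp only [Matrix.mul_apply, Fin.sum_univ_two]
    linear_combination (A 1 0 * P.x + A 1 1) * hx' + B 0 0 * hx
  · rw [e, mul_pow]
    linear_combination (A 1 0 * P.x + A 1 1) ^ (g + 1) * hy' + m * hy

theorem IsGenericallyRepresentedBy.symm {C D : HyperellipticCurve k g} {σ : C.Iso D}
    {A : Matrix (Fin 2) (Fin 2) k} {l : k} (hσ : IsGenericallyRepresentedBy σ A l)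
    (hA : A.det ≠ 0) (hl : l ≠ 0) :
    IsGenericallyRepresentedBy σ.symm A.adjugate (A.det ^ (g + 1) / l) := by
  filter_upwards [σ.symm.eventually_exists_chart hσ] with Q h
  obtain ⟨P, hP, h1, Q', hQ', hx, hy⟩ := h
  have e : σ.toEquiv (C.chart P) = D.chart Q := by
    rw [← hP]
    exact σ.toEquiv.apply_symm_apply _
  obtain rfl := D.chart_injective (e.symm.trans hQ')
  have e1 : (A.adjugate 1 0 * Q.x + A.adjugate 1 1) * (A 1 0 * P.x + A 1 1) = A.det := by
    simp only [Matrix.adjugate_fin_two, Matrix.det_fin_two]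
    simp
    linear_combination -(A 1 0) * hx
  refine ⟨left_ne_zero_of_mul (e1 ▸ hA), P, hP, ?_, ?_⟩
  · apply mul_right_cancel₀ h1
    rw [mul_assoc, e1]
    simp only [Matrix.adjugate_fin_two, Matrix.det_fin_two]
    simp
    linear_combination -(A 1 1) * hx
  · apply mul_right_cancel₀ (pow_ne_zero (g + 1) h1)
    rw [mul_assoc, ← mul_pow, e1, mul_assoc, hy]
    field_simp

/-- Representing pairs can be rescaled; this absorbs the determinants produced by using adjugates as
inverses. -/
theorem IsGenericallyRepresentedBy.smul {C D : HyperellipticCurve k g} {σ : C.Iso D}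
    {A : Matrix (Fin 2) (Fin 2) k} {l : k} (hσ : IsGenericallyRepresentedBy σ A l)
    {c : k} (hc : c ≠ 0) : IsGenericallyRepresentedBy σ (c • A) (c ^ (g + 1) * l) := by
  filter_upwards [hσ] with P h
  obtain ⟨h, Q, hQ, hx, hy⟩ := h
  simp only [Matrix.smul_apply, smul_eq_mul, mul_assoc, ← mul_add]
  refine ⟨mul_ne_zero hc h, Q, hQ, by rw [← hx]; ring, ?_⟩
  rw [mul_pow, ← hy]
  ring

theorem isGenericallyRepresentedBy_refl (C : HyperellipticCurve k g) :
    IsGenericallyRepresentedBy (Iso.refl C) 1 1 :=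
  Eventually.of_forall fun P => ⟨by simp, P, rfl, by simp, by simp⟩

theorem isGenericallyRepresentedBy_hyperellipticInvolution (C : HyperellipticCurve k g) :
    IsGenericallyRepresentedBy (C.hyperellipticInvolution) 1 (-1) :=
  Eventually.of_forall fun P => ⟨by simp, P.flip, rfl, by simp [AffineDoubleCover.flip],
    by simp [AffineDoubleCover.flip]⟩

/-! ### Translations -/

theorem eval_fInf_zero (C : HyperellipticCurve k g) :
    C.fInf.eval 0 = C.f.coeff (2 * g + 2) := by
  rw [← coeff_zero_eq_eval_zero, fInf, coeff_reflect, revAt_zero]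

theorem eval_fInf_translate {C D : HyperellipticCurve k g} {p : k}
    (h : D.f = C.f.comp (X + Polynomial.C p)) {u : k} (hu : 1 + p * u ≠ 0) :
    D.fInf.eval u = (1 + p * u) ^ (2 * g + 2) * C.fInf.eval (u / (1 + p * u)) := by
  by_cases hu0 : u = 0
  -- At infinity the claim is that translation preserves the coefficient of `x^(2g+2)`, be it zero
  -- or the leading one.
  · subst hu0
    simp only [mul_zero, add_zero, one_pow, zero_div, one_mul, eval_fInf_zero]
    have h1 : D.f = taylor p C.f := by rw [h, taylor_apply]
    rcases C.natDegree_le.lt_or_eq with h2 | h2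
    · rw [coeff_eq_zero_of_natDegree_lt h2, coeff_eq_zero_of_natDegree_lt]
      rwa [h1, natDegree_taylor]
    · rw [h1, ← h2, coeff_taylor_natDegree, leadingCoeff]
  · rw [eval_fInf _ hu0, eval_fInf _ (div_ne_zero hu0 hu), h, eval_comp, ← mul_assoc, ← mul_pow,
      mul_div_cancel₀ _ hu]
    congr 2
    simp
    field_simp

section Translate

variable {C D : HyperellipticCurve k g} {p : k}

/-- The map `(x, y) ↦ (x + p, y)`. -/
noncomputable def translate (h : D.f = C.f.comp (X + Polynomial.C p)) : D.Point → C.Point :=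
  open Classical in
  Quot.lift (Sum.elim
    (fun P => C.chart ⟨P.x + p, P.y, P.equation.trans (by simp [congrArg (eval P.x) h])⟩)
    -- These points have affine abscissa `-p`, so they land over `x = 0`, outside the chart at
    -- infinity.
    (fun Q => if hQ : 1 + p * Q.x = 0 then
        C.chart ⟨0, Q.y / Q.x ^ (g + 1), by
          have h0 : Q.x ≠ 0 := by rintro h0; simp [h0] at hQ
          have h1 : Q.x⁻¹ + p = 0 := by field_simp; linear_combination hQ
          rw [div_pow, Q.equation, eval_fInf _ h0, h, ← pow_mul,
            show (g + 1) * 2 = 2 * g + 2 by ring, mul_div_cancel_left₀ _ (pow_ne_zero _ h0)]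
          simp [h1]⟩
      else C.chartInf ⟨Q.x / (1 + p * Q.x), Q.y / (1 + p * Q.x) ^ (g + 1), by
          rw [div_pow, Q.equation, eval_fInf_translate h hQ, ← pow_mul,
            show (g + 1) * 2 = 2 * g + 2 by ring, mul_div_cancel_left₀ _ (pow_ne_zero _ hQ)]⟩)) (by
    rintro _ _ ⟨P, Q, h0, hx, hy⟩
    have e : 1 + p * Q.x = (P.x + p) / P.x := by rw [hx]; field_simp
    simp only [Sum.elim_inl, Sum.elim_inr]
    split_ifs with hQ
    · congr 1
      have h1 : P.x + p = 0 := by simpa [e, h0] using hQ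
      ext
      · exact h1
      · simp [hx, hy, h0]
    · have h1 : P.x + p ≠ 0 := by
        rintro h1
        rw [e, h1, zero_div] at hQ
        exact hQ rfl
      symm
      apply C.chartInf_eq_chart
      · exact h1
      · simp only [e]
        rw [hx]
        field_simp
      · simp only [e]
        rw [hy, div_pow, div_div_div_cancel_right₀ (pow_ne_zero _ h0)])

@[simp]
theorem translate_chart (h : D.f = C.f.comp (X + Polynomial.C p)) (P : AffineDoubleCover D.f) :
    translate h (D.chart P) = C.chart ⟨P.x + p, P.y, P.equation.trans (by simp [congrArg (eval P.x) h])⟩ := rfl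

theorem translate_chartInf (h : D.f = C.f.comp (X + Polynomial.C p))
    {Q : AffineDoubleCover D.fInf} (hQ : 1 + p * Q.x ≠ 0) :
    ∃ R : AffineDoubleCover C.fInf, translate h (D.chartInf Q) = C.chartInf R ∧
      R.x = Q.x / (1 + p * Q.x) ∧ R.y = Q.y / (1 + p * Q.x) ^ (g + 1) := by
  refine ⟨_, dif_neg hQ, rfl, rfl⟩

theorem translate_translate (h : D.f = C.f.comp (X + Polynomial.C p))
    (h' : C.f = D.f.comp (X + Polynomial.C (-p))) (q : D.Point) :
    translate h' (translate h q) = q := by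
  rcases D.exists_chart_or q with ⟨P, rfl⟩ | ⟨Q, hQ, rfl⟩
  · simp
  · obtain ⟨R, hR, hx, hy⟩ := translate_chartInf h (Q := Q) (by simp [hQ])
    obtain ⟨S, hS, hx', hy'⟩ := translate_chartInf h' (Q := R) (by simp [hx, hQ])
    rw [hR, hS]
    congr 1
    ext
    · simp [hx', hx, hQ]
    · simp [hy', hx, hy, hQ]

theorem isMorphism_translate (h : D.f = C.f.comp (X + Polynomial.C p)) :
    D.IsMorphism C (translate h) := by
  refine isMorphism_of_isRationalNear (fun P => Or.inl ?_) (fun Q => ?_)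
  · exact ⟨1, Polynomial.C (X + Polynomial.C p), X, 1, by simp [value], fun P' _ =>
      ⟨by simp [value], _, rfl, by simp [value, evalEval_C], by simp [value]⟩⟩
  · by_cases hQ : 1 + p * Q.x = 0
    · left
      have h0 : Q.x ≠ 0 := by rintro h0; simp [h0] at hQ
      -- Both coordinates are put over the denominator `x^(g+1)`; the first is `1/x + p`.
      refine ⟨Polynomial.C X, Polynomial.C (X ^ g * (1 + Polynomial.C p * X)), X,
        Polynomial.C (X ^ (g + 1)), by simpa [value, evalEval_C] using h0, fun Q' hQ' => ?_⟩
      replace hQ' : Q'.x ≠ 0 := by simpa [value, evalEval_C] using hQ'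
      obtain ⟨P, hP, hx, hy⟩ := D.exists_chart_eq_chartInf hQ'
      refine ⟨by simpa [value, evalEval_C] using hQ', _, by rw [Function.comp_apply, ← hP]; rfl,
        ?_, ?_⟩
      · simp only [value, evalEval_C, eval_mul, eval_pow, eval_X, eval_add, eval_one, eval_C, hx]
        field_simp
        ring
      · simp only [value, evalEval_C, eval_pow, eval_X, hy, evalEval_X]
        field_simp
    · right
      refine ⟨Polynomial.C (1 + Polynomial.C p * X),
        Polynomial.C (X * (1 + Polynomial.C p * X) ^ g), X,
        Polynomial.C ((1 + Polynomial.C p * X) ^ (g + 1)), by simpa [value, evalEval_C] using hQ,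
        fun Q' hQ' => ?_⟩
      replace hQ' : 1 + p * Q'.x ≠ 0 := by simpa [value, evalEval_C] using hQ'
      obtain ⟨R, hR, hx, hy⟩ := translate_chartInf h hQ'
      refine ⟨by simpa [value, evalEval_C] using pow_ne_zero (g + 1) hQ', R, hR, ?_, ?_⟩
      · simp only [value, evalEval_C, eval_mul, eval_pow, eval_X, eval_add, eval_one, eval_C, hx]
        rw [pow_succ, mul_comm (_ ^ g), ← mul_assoc, div_mul_cancel₀ _ hQ']
      · simp only [value, evalEval_C, eval_mul, eval_pow, eval_X, eval_add, eval_one, eval_C, hy,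
          evalEval_X]
        field_simp

theorem exists_translation (C : HyperellipticCurve k g) (p : k) :
    ∃ (D : HyperellipticCurve k g) (τ : D.Iso C),
      IsGenericallyRepresentedBy τ !![1, p; 0, 1] 1 := by
  have hsep : (C.f.comp (X + Polynomial.C p)).Separable := by
    obtain ⟨a, b, hab⟩ := C.separable
    refine ⟨a.comp (X + Polynomial.C p), b.comp (X + Polynomial.C p), ?_⟩
    have := congrArg (fun q => q.comp (X + Polynomial.C p)) hab
    simpa [derivative_comp] using this
  have hdeg : (C.f.comp (X + Polynomial.C p)).natDegree = C.f.natDegree := by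
    rw [natDegree_comp, natDegree_X_add_C, mul_one]
  let D : HyperellipticCurve k g := ⟨_, hsep, by rw [hdeg]; exact C.degree_eq⟩
  have h : D.f = C.f.comp (X + Polynomial.C p) := rfl
  have h' : C.f = D.f.comp (X + Polynomial.C (-p)) := by
    rw [h, comp_assoc]
    simp
  have h'' : D.f = C.f.comp (X + Polynomial.C (- -p)) := by rw [neg_neg]
  have e : (translate h : D.Point → C.Point) = translate h'' := by
    congr 1
    rw [neg_neg]
  refine ⟨D, ⟨⟨translate h, translate h', translate_translate h h', fun q => ?_⟩,
    isMorphism_translate h, isMorphism_translate h'⟩, Eventually.of_forall fun P => ?_⟩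
  · rw [e]
    exact translate_translate h' h'' q
  · refine ⟨by simp, _, rfl, by simp, by simp⟩

end Translate

/-! ### Inversion -/

section Inversion

theorem reflect_reflect (N : ℕ) (f : k[X]) : reflect N (reflect N f) = f := by
  ext i
  rw [coeff_reflect, coeff_reflect, revAt_invol]

/-- The map exchanging the two charts. -/
noncomputable def swapCharts {C D : HyperellipticCurve k g} (h : D.f = C.fInf) (h' : D.fInf = C.f) :
    D.Point → C.Point :=
  Quot.lift (Sum.elim (fun P => C.chartInf ⟨P.x, P.y, P.equation.trans (congrArg (eval P.x) h)⟩)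
    (fun Q => C.chart ⟨Q.x, Q.y, Q.equation.trans (congrArg (eval Q.x) h')⟩)) (by
    rintro _ _ ⟨P, Q, h0, hx, hy⟩
    apply C.chartInf_eq_chart
    · simpa [hx] using h0
    · simp [hx]
    · simp [hx, hy, h0])

theorem swapCharts_swapCharts {C D : HyperellipticCurve k g} (h : D.f = C.fInf)
    (h' : D.fInf = C.f) (q : D.Point) : swapCharts h'.symm h.symm (swapCharts h h' q) = q := by
  rcases q with ⟨P | Q⟩ <;> rfl

theorem isMorphism_swapCharts {C D : HyperellipticCurve k g} (h : D.f = C.fInf)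
    (h' : D.fInf = C.f) : D.IsMorphism C (swapCharts h h') := by
  refine isMorphism_of_isRationalNear (fun P => Or.inr ?_) (fun P => Or.inl ?_)
  all_goals
    exact ⟨1, Polynomial.C X, X, 1, by simp [value], fun P' _ =>
      ⟨by simp [value], _, rfl, by simp [value, evalEval_C], by simp [value]⟩⟩

/-- The two top coefficients of `fInf` are the two lowest of `f`, and both vanishing would mean `X²
∣ f`. -/
theorem natDegree_fInf (C : HyperellipticCurve k g) :
    C.fInf.natDegree = 2 * g + 1 ∨ C.fInf.natDegree = 2 * g + 2 := by
  have h1 : C.fInf.natDegree ≤ 2 * g + 2 := by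
    refine (natDegree_reflect_le).trans ?_
    simpa using C.natDegree_le
  have h2 : C.fInf.coeff (2 * g + 2) ≠ 0 ∨ C.fInf.coeff (2 * g + 1) ≠ 0 := by
    by_contra! h
    rw [fInf, coeff_reflect, coeff_reflect, revAt_le le_rfl, revAt_le (by omega),
      show 2 * g + 2 - (2 * g + 1) = 1 by omega, Nat.sub_self] at h
    obtain ⟨s, hs⟩ : X * X ∣ C.f := by
      rw [← sq, X_pow_dvd_iff]
      intro d hd
      interval_cases d
      · exact h.1
      · exact h.2
    exact not_isUnit_X (C.separable.squarefree _ ⟨s, hs⟩)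
  rcases h2 with h2 | h2
  · have := le_natDegree_of_ne_zero h2
    omega
  · have := le_natDegree_of_ne_zero h2
    omega

variable [IsAlgClosed k]

/-- A repeated linear factor `q` reflects to a repeated factor of `f`, hence to a unit; but then
`deg f ≤ 2g`. -/
theorem separable_fInf (C : HyperellipticCurve k g) : C.fInf.Separable := by
  rw [PerfectField.separable_iff_squarefree]
  have h0 : C.fInf ≠ 0 := by
    intro h
    have := reflect_reflect (2 * g + 2) C.f
    rw [show reflect (2 * g + 2) C.f = 0 from h, reflect_zero] at this
    exact C.separable.ne_zero this.symm
  rw [squarefree_iff_irreducible_sq_not_dvd_of_ne_zero h0]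
  intro q hq hdvd
  have hq1 := IsAlgClosed.degree_eq_one_of_irreducible k hq
  have hq1' : q.natDegree = 1 := natDegree_eq_of_degree_eq_some hq1
  obtain ⟨s, hs⟩ := hdvd
  have hs0 : s ≠ 0 := by
    rintro rfl
    rw [mul_zero] at hs
    exact h0 hs
  have hsd : s.natDegree ≤ 2 * g := by
    have h1 : C.fInf.natDegree ≤ 2 * g + 2 := by
      refine (natDegree_reflect_le).trans ?_
      simpa using C.natDegree_le
    rw [hs, natDegree_mul (mul_ne_zero hq.ne_zero hq.ne_zero) hs0,
      natDegree_mul hq.ne_zero hq.ne_zero] at h1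
    omega
  have h1 : C.f = reflect 1 q * reflect 1 q * reflect (2 * g) s := by
    rw [← reflect_mul q q hq1'.le hq1'.le, ← reflect_mul (q * q) s ?_ hsd, ← hs,
      show 1 + 1 + 2 * g = 2 * g + 2 by ring]
    · exact (reflect_reflect _ _).symm
    · rw [natDegree_mul hq.ne_zero hq.ne_zero, hq1']
  have h2 : IsUnit (reflect 1 q) := C.separable.squarefree _ ⟨_, h1⟩
  have h3 : C.f.natDegree ≤ 2 * g := by
    rw [h1]
    refine (natDegree_mul_le_of_le (natDegree_mul_le_of_le (natDegree_eq_zero_of_isUnit h2).le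
      (natDegree_eq_zero_of_isUnit h2).le) ((natDegree_reflect_le).trans
        (max_le le_rfl hsd))).trans ?_
    omega
  rcases C.degree_eq with h | h <;> omega

/-- The last clause turns points at infinity of `C` into affine points of `D`, reducing questions at
infinity to affine ones. -/
theorem exists_inversion (C : HyperellipticCurve k g) :
    ∃ (D : HyperellipticCurve k g) (τ : D.Iso C),
      IsGenericallyRepresentedBy τ !![0, 1; 1, 0] 1 ∧
      ∀ Q, ∃ P, τ.toEquiv (D.chart P) = C.chartInf Q ∧ P.x = Q.x ∧ P.y = Q.y := by
  let D : HyperellipticCurve k g := ⟨C.fInf, C.separable_fInf, C.natDegree_fInf⟩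
  have h : D.f = C.fInf := rfl
  have h' : D.fInf = C.f := reflect_reflect _ _
  refine ⟨D, ⟨⟨swapCharts h h', swapCharts h'.symm h.symm, swapCharts_swapCharts h h',
    swapCharts_swapCharts h'.symm h.symm⟩, isMorphism_swapCharts h h',
    isMorphism_swapCharts h'.symm h.symm⟩, ?_, fun Q => ⟨Q, rfl, rfl, rfl⟩⟩
  filter_upwards [AffineDoubleCover.eventually_eval_ne_zero (f := D.f) X_ne_zero] with P hP
  rw [eval_X] at hP
  obtain ⟨R, hR, hx, hy⟩ := C.exists_chart_eq_chartInf (Q := P) hP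
  exact ⟨by simpa using hP, R, hR.symm, by simp [hx, hP], by simp [hy, hP]⟩

end Inversion

end HyperellipticCurve

namespace HyperellipticCurve

open Filter AffineDoubleCover

variable {k : Type*} [Field k] {g : ℕ}

/-! ### Conjugation -/

/-- The conjugate of an automorphism by an isomorphism. -/
def Iso.conj {C D : HyperellipticCurve k g} (ρ : D.Iso C) (σ : C.Aut) : D.Aut :=
  (ρ.trans σ).trans ρ.symm

theorem IsGenericallyRepresentedBy.conj {C D : HyperellipticCurve k g} {ρ : D.Iso C} {σ : C.Aut}
    {A M : Matrix (Fin 2) (Fin 2) k} {l m : k} (hσ : IsGenericallyRepresentedBy σ A l)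
    (hρ : IsGenericallyRepresentedBy ρ M m) (hM : M.det ≠ 0) (hm : m ≠ 0) :
    IsGenericallyRepresentedBy (ρ.conj σ) (M.adjugate * (A * M)) (M.det ^ (g + 1) * l) := by
  have := (hρ.trans hσ).trans (hρ.symm hM hm)
  rwa [show M.det ^ (g + 1) / m * (l * m) = M.det ^ (g + 1) * l by field_simp] at this

theorem IsGenericallyRepresentedBy.of_isRepresentedBy {C D : HyperellipticCurve k g} {σ : C.Iso D}
    {μ μ' : kˣ} (h : IsRepresentedBy σ (diagOne μ) μ') :
    IsGenericallyRepresentedBy σ !![(μ : k), 0; 0, 1] μ' :=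
  Eventually.of_forall fun P => by
    obtain ⟨Q, hQ, hx, hy⟩ := h P (by simp [diagOne])
    exact ⟨by simp, Q, hQ, by simp [hx, diagOne], by simp [hy, diagOne]⟩

theorem Iso.conj_injective {C D : HyperellipticCurve k g} (ρ : D.Iso C) :
    Function.Injective ρ.conj := by
  intro σ τ h
  apply Iso.ext
  ext p
  obtain ⟨q, rfl⟩ := ρ.toEquiv.surjective p
  exact ρ.toEquiv.symm.injective (Equiv.congr_fun (congrArg Iso.toEquiv h) q)

theorem Iso.conj_one {C D : HyperellipticCurve k g} (ρ : D.Iso C) : ρ.conj 1 = 1 :=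
  Iso.ext (Equiv.self_trans_symm ρ.toEquiv)

theorem Iso.conj_pow {C D : HyperellipticCurve k g} (ρ : D.Iso C) (σ : C.Aut) (n : ℕ) :
    ρ.conj (σ ^ n) = ρ.conj σ ^ n := by
  induction n with
  | zero => exact ρ.conj_one
  | succ n ih =>
    rw [pow_succ, pow_succ, ← ih]
    apply Iso.ext
    ext p
    exact congrArg (fun q => ρ.toEquiv.symm ((σ ^ n).toEquiv q))
      (ρ.toEquiv.apply_symm_apply (σ.toEquiv (ρ.toEquiv p))).symm

theorem IsGenericallyRepresentedBy.pow {C : HyperellipticCurve k g} {σ : C.Aut}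
    {A : Matrix (Fin 2) (Fin 2) k} {l : k} (hσ : IsGenericallyRepresentedBy σ A l) (n : ℕ) :
    IsGenericallyRepresentedBy (σ ^ n) (A ^ n) (l ^ n) := by
  induction n with
  | zero =>
    rw [pow_zero, pow_zero, pow_zero]
    exact isGenericallyRepresentedBy_refl C
  | succ n ih =>
    rw [pow_succ, pow_succ, pow_succ]
    exact hσ.trans ih

/-- The corner entry is `n e^(n-1) h`; the extra factor `e` avoids the exponent `n - 1`. -/
theorem _root_.Matrix.upperTriangular_pow (e h : k) (n : ℕ) :
    (!![e, h; 0, e] ^ n) 1 1 = e ^ n ∧ e * (!![e, h; 0, e] ^ n) 0 1 = n * e ^ n * h := by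
  induction n with
  | zero => simp
  | succ n ih =>
    rw [pow_succ']
    simp only [Matrix.mul_apply, Fin.sum_univ_two]
    simp
    rw [ih.1]
    refine ⟨by ring, ?_⟩
    linear_combination e * ih.2

/-! ### Rigidity -/

section Rigidity

variable [IsAlgClosed k]

/-- With denominators cleared, the generic formulas are identities of regular functions, so they
persist at every affine point with affine image. -/
theorem IsGenericallyRepresentedBy.eq_of_chart_eq {C D : HyperellipticCurve k g} {σ : C.Iso D}
    {A : Matrix (Fin 2) (Fin 2) k} {l : k} (hσ : IsGenericallyRepresentedBy σ A l)
    {P : AffineDoubleCover C.f} {Q : AffineDoubleCover D.f} (h : σ.toEquiv (C.chart P) = D.chart Q) :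
    Q.x * (A 1 0 * P.x + A 1 1) = A 0 0 * P.x + A 0 1 ∧
      Q.y * (A 1 0 * P.x + A 1 1) ^ (g + 1) = l * P.y := by
  have hsq := C.separable.squarefree
  have hx := (σ.isMorphism.2 _ _ D.isOpen_range_chart D.isRegularOn_xCoord).1
  have hy := (σ.isMorphism.2 _ _ D.isOpen_range_chart D.isRegularOn_yCoord).1
  have hP : P ∈ C.chart ⁻¹' (σ.toEquiv ⁻¹' Set.range D.chart) := ⟨Q, h.symm⟩
  constructor
  · have := hx.mul_value_eq hsq C.natDegree_pos hP
      (r := Polynomial.C (Polynomial.C (A 1 0) * X + Polynomial.C (A 1 1)))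
      (s := Polynomial.C (Polynomial.C (A 0 0) * X + Polynomial.C (A 0 1))) (by
        filter_upwards [hσ] with P' h'
        obtain ⟨-, Q', hQ', h1, -⟩ := h'
        simp [value, evalEval_C, hQ', ← h1, mul_comm (_ + _)])
    simpa [value, evalEval_C, h, mul_comm (_ + _)] using this
  · have := hy.mul_value_eq hsq C.natDegree_pos hP
      (r := Polynomial.C ((Polynomial.C (A 1 0) * X + Polynomial.C (A 1 1)) ^ (g + 1)))
      (s := Polynomial.C (Polynomial.C l) * X) (by
        filter_upwards [hσ] with P' h'
        obtain ⟨-, Q', hQ', -, h1⟩ := h'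
        simp [value, evalEval_C, hQ', ← h1, mul_comm (_ ^ _)])
    simpa [value, evalEval_C, h, mul_comm (_ ^ _)] using this

/-- Were the image at infinity, inversion would make it an affine point with `x = 0`, and the
cleared formula would force `γx + δ = 0`. -/
theorem IsGenericallyRepresentedBy.mem_range_chart {C D : HyperellipticCurve k g} {σ : C.Iso D}
    {A : Matrix (Fin 2) (Fin 2) k} {l : k} (hσ : IsGenericallyRepresentedBy σ A l)
    {P : AffineDoubleCover C.f} (hP : A 1 0 * P.x + A 1 1 ≠ 0) :
    ∃ Q, σ.toEquiv (C.chart P) = D.chart Q := by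
  refine (D.exists_chart_or _).resolve_right ?_
  rintro ⟨Q, hQ, h⟩
  obtain ⟨E, τ, hτ, hτ'⟩ := D.exists_inversion
  obtain ⟨R, hR, hx, -⟩ := hτ' Q
  have h1 := (hσ.trans (hτ.symm (by simp) one_ne_zero)).eq_of_chart_eq (P := P) (Q := R) (by
    change τ.toEquiv.symm (σ.toEquiv (C.chart P)) = _
    rw [h, ← hR, Equiv.symm_apply_apply])
  apply hP
  have h2 := h1.1
  rw [hx, hQ, Matrix.adjugate_fin_two_of] at h2
  simp [Matrix.mul_apply, Fin.sum_univ_two] at h2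
  linear_combination h2

theorem IsGenericallyRepresentedBy.isRepresentedBy {C D : HyperellipticCurve k g} {σ : C.Iso D}
    {A : GL (Fin 2) k} {l : kˣ} (hσ : IsGenericallyRepresentedBy σ (A : Matrix (Fin 2) (Fin 2) k) l) :
    IsRepresentedBy σ A l := by
  intro P hP
  obtain ⟨Q, hQ⟩ := hσ.mem_range_chart hP
  obtain ⟨hx, hy⟩ := hσ.eq_of_chart_eq hQ
  exact ⟨Q, hQ, eq_div_of_mul_eq hP hx, eq_div_of_mul_eq (pow_ne_zero _ hP) hy⟩

theorem IsGenericallyRepresentedBy.apply_chart_eq {C : HyperellipticCurve k g} {σ : C.Aut}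
    (hσ : IsGenericallyRepresentedBy σ 1 1) (P : AffineDoubleCover C.f) :
    σ.toEquiv (C.chart P) = C.chart P := by
  obtain ⟨Q, hQ⟩ := hσ.mem_range_chart (P := P) (by simp)
  obtain ⟨hx, hy⟩ := hσ.eq_of_chart_eq hQ
  rw [hQ]
  congr 1
  ext
  · simpa using hx
  · simpa using hy

theorem IsGenericallyRepresentedBy.eq_one {C : HyperellipticCurve k g} {σ : C.Aut}
    (hσ : IsGenericallyRepresentedBy σ 1 1) : σ = 1 := by
  apply Iso.ext
  ext p
  change σ.toEquiv p = p
  rcases C.exists_chart_or p with ⟨P, rfl⟩ | ⟨Q, -, rfl⟩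
  · exact hσ.apply_chart_eq P
  · obtain ⟨E, τ, hτ, hτ'⟩ := C.exists_inversion
    obtain ⟨R, hR, -, -⟩ := hτ' Q
    -- The inversion has determinant `-1`, so its adjugate conjugates the identity to `-1`;
    -- rescaling by `-1` restores the pair `(1, 1)`.
    have h1 := (hσ.conj hτ (by simp) one_ne_zero).smul (neg_ne_zero.2 one_ne_zero)
    rw [one_mul, Matrix.adjugate_mul, Matrix.det_fin_two_of] at h1
    simp only [smul_smul] at h1
    rw [show (-1 : k) * (0 * 0 - 1 * 1) = 1 by ring, one_smul,
      show (-1 : k) ^ (g + 1) * ((0 * 0 - 1 * 1) ^ (g + 1) * 1) = 1 by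
        rw [mul_one, ← mul_pow]; simp] at h1
    have h2 : τ.toEquiv.symm (σ.toEquiv (τ.toEquiv (E.chart R))) = E.chart R :=
      h1.apply_chart_eq R
    rwa [Equiv.symm_apply_eq, hR] at h2

/-- An isomorphism is determined by the matrix and the scalar which represent it. -/
theorem IsGenericallyRepresentedBy.eq {C D : HyperellipticCurve k g} {σ τ : C.Iso D}
    {A : Matrix (Fin 2) (Fin 2) k} {l : k} (hσ : IsGenericallyRepresentedBy σ A l)
    (hτ : IsGenericallyRepresentedBy τ A l) (hA : A.det ≠ 0) (hl : l ≠ 0) : σ = τ := by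
  have h1 := (hσ.trans (hτ.symm hA hl)).smul (inv_ne_zero hA)
  rw [Matrix.adjugate_mul, smul_smul, inv_mul_cancel₀ hA, one_smul, div_mul_cancel₀ _ hl, inv_pow,
    inv_mul_cancel₀ (pow_ne_zero _ hA)] at h1
  have h2 := congrArg Iso.toEquiv (IsGenericallyRepresentedBy.eq_one h1)
  apply Iso.ext
  ext p
  have h3 : τ.toEquiv.symm (σ.toEquiv p) = p := Equiv.congr_fun h2 p
  rwa [Equiv.symm_apply_eq] at h3

/-- The fixed-point equation `γx² + (δ - α)x - β = 0` holds for almost all points, so its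
coefficients vanish. -/
theorem IsGenericallyRepresentedBy.eq_scalar {C D : HyperellipticCurve k g} {σ : C.Iso D}
    {A : Matrix (Fin 2) (Fin 2) k} {l m : k} (hσ : IsGenericallyRepresentedBy σ A l)
    (hσ' : IsGenericallyRepresentedBy σ 1 m) : A 0 1 = 0 ∧ A 1 0 = 0 ∧ A 0 0 = A 1 1 := by
  have h : Polynomial.C (A 1 0) * X ^ 2 + Polynomial.C (A 1 1 - A 0 0) * X +
      Polynomial.C (-A 0 1) = 0 := by
    by_contra hne
    obtain ⟨P, ⟨-, Q, hQ, hx, -⟩, ⟨-, Q', hQ', hx', -⟩, h⟩ := (hσ.and (hσ'.and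
      (AffineDoubleCover.eventually_eval_ne_zero (f := C.f) hne))).exists
    obtain rfl := D.chart_injective (hQ.symm.trans hQ')
    have hx' : Q.x = P.x := by simpa using hx'
    apply h
    simp
    rw [hx'] at hx
    linear_combination hx
  have h0 := congrArg (fun p => p.coeff 0) h
  have h1 := congrArg (fun p => p.coeff 1) h
  have h2 := congrArg (fun p => p.coeff 2) h
  simp [coeff_X, coeff_C, -map_sub, -map_neg] at h0 h1 h2
  exact ⟨h0, h2, (sub_eq_zero.1 h1).symm⟩

theorem IsGenericallyRepresentedBy.scalar_unique {C D : HyperellipticCurve k g} {σ : C.Iso D}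
    {l m : k} (hσ : IsGenericallyRepresentedBy σ 1 l)
    (hσ' : IsGenericallyRepresentedBy σ 1 m) : l = m := by
  obtain ⟨P, ⟨-, Q, hQ, -, hy⟩, ⟨-, Q', hQ', -, hy'⟩, h⟩ :=
    (hσ.and (hσ'.and C.eventually_y_ne_zero)).exists
  obtain rfl := D.chart_injective (hQ.symm.trans hQ')
  exact mul_right_cancel₀ h (hy.symm.trans hy')

theorem hyperellipticInvolution_ne_one (h2 : (2 : k) ≠ 0) (C : HyperellipticCurve k g) :
    C.hyperellipticInvolution ≠ 1 := by
  intro h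
  have h1 := C.isGenericallyRepresentedBy_hyperellipticInvolution
  rw [h] at h1
  have h3 := (isGenericallyRepresentedBy_refl C).scalar_unique h1
  apply h2
  linear_combination h3

/-! ### The hyperelliptic involution is central -/

section Reduced

variable (h2 : (2 : k) ≠ 0) (hg : 2 ≤ g)
include h2 hg

/-- If `ρ` is represented by `(A, l)`, composing with the involution on either side gives `(A, -l)`.
-/
theorem Iso.conj_hyperellipticInvolution {C D : HyperellipticCurve k g} (ρ : D.Iso C) :
    ρ.conj C.hyperellipticInvolution = D.hyperellipticInvolution := by
  obtain ⟨A, l, hA, hl, h⟩ := ρ.exists_isGenericallyRepresentedBy h2 hg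
  have e : ρ.trans C.hyperellipticInvolution = D.hyperellipticInvolution.trans ρ := by
    refine IsGenericallyRepresentedBy.eq (A := A) (l := -l) ?_ ?_ hA (neg_ne_zero.2 hl)
    · simpa using h.trans C.isGenericallyRepresentedBy_hyperellipticInvolution
    · simpa using D.isGenericallyRepresentedBy_hyperellipticInvolution.trans h
  rw [Iso.conj, e]
  apply Iso.ext
  ext p
  exact ρ.toEquiv.symm_apply_apply _

theorem mem_normalClosure_iff (C : HyperellipticCurve k g) (σ : C.Aut) :
    σ ∈ Subgroup.normalClosure {C.hyperellipticInvolution} ↔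
      σ = 1 ∨ σ = C.hyperellipticInvolution := by
  have hmul : C.hyperellipticInvolution * C.hyperellipticInvolution = 1 :=
    Iso.ext (Equiv.ext C.flip_flip)
  have hinv : C.hyperellipticInvolution⁻¹ = C.hyperellipticInvolution :=
    inv_eq_of_mul_eq_one_left hmul
  constructor
  · let H : Subgroup C.Aut :=
      { carrier := {1, C.hyperellipticInvolution}
        mul_mem' := by
          rintro _ _ (rfl | rfl) (rfl | rfl) <;> simp [hmul]
        one_mem' := by simp
        inv_mem' := by
          rintro _ (rfl | rfl) <;> simp [hinv] }
    have hH : H.Normal := by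
      refine ⟨?_⟩
      rintro _ (rfl | rfl) τ
      · left; simp
      · right
        exact (Iso.symm τ).conj_hyperellipticInvolution h2 hg
    have : Subgroup.normalClosure {C.hyperellipticInvolution} ≤ H :=
      Subgroup.normalClosure_le_normal (by
        rw [Set.singleton_subset_iff]
        exact Or.inr rfl)
    exact fun h => this h
  · rintro (rfl | rfl)
    · exact one_mem _
    · exact Subgroup.subset_normalClosure rfl

theorem IsGenericallyRepresentedBy.of_mem_normalClosure {C : HyperellipticCurve k g} {σ : C.Aut}
    (h : σ ∈ Subgroup.normalClosure {C.hyperellipticInvolution}) :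
    ∃ l : k, (l = 1 ∨ l = -1) ∧ IsGenericallyRepresentedBy σ 1 l := by
  rcases (mem_normalClosure_iff h2 hg C σ).1 h with rfl | rfl
  · exact ⟨1, Or.inl rfl, isGenericallyRepresentedBy_refl C⟩
  · exact ⟨-1, Or.inr rfl, C.isGenericallyRepresentedBy_hyperellipticInvolution⟩

end Reduced

theorem Iso.conj_mem_normalClosure_iff (h2 : (2 : k) ≠ 0) (hg : 2 ≤ g)
    {C D : HyperellipticCurve k g} (ρ : D.Iso C) (σ : C.Aut) :
    ρ.conj σ ∈ Subgroup.normalClosure {D.hyperellipticInvolution} ↔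
      σ ∈ Subgroup.normalClosure {C.hyperellipticInvolution} := by
  rw [mem_normalClosure_iff h2 hg, mem_normalClosure_iff h2 hg, ← ρ.conj_one,
    ← ρ.conj_hyperellipticInvolution h2 hg, ρ.conj_injective.eq_iff, ρ.conj_injective.eq_iff]

/-! ### Diagonalisation -/

/-- Unless infinity is already fixed, a finite fixed point `p` exists because `k` is algebraically
closed; it is translated to 0, then inverted to infinity. -/
theorem exists_conj_fixing_infinity (h2 : (2 : k) ≠ 0) (hg : 2 ≤ g) {C : HyperellipticCurve k g}
    (σ : C.Aut) : ∃ (D : HyperellipticCurve k g) (ρ : D.Iso C) (e h d l : k), e ≠ 0 ∧ d ≠ 0 ∧ l ≠ 0 ∧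
      IsGenericallyRepresentedBy (ρ.conj σ) !![e, h; 0, d] l := by
  obtain ⟨A, l, hA, hl, h⟩ := σ.exists_isGenericallyRepresentedBy h2 hg
  suffices H : ∃ (D : HyperellipticCurve k g) (ρ : D.Iso C) (B : Matrix (Fin 2) (Fin 2) k) (m : k),
      B.det ≠ 0 ∧ m ≠ 0 ∧ B 1 0 = 0 ∧ IsGenericallyRepresentedBy (ρ.conj σ) B m by
    obtain ⟨D, ρ, B, m, hB, hm, h0, hB'⟩ := H
    rw [Matrix.det_fin_two, h0, mul_zero, sub_zero] at hB
    refine ⟨D, ρ, B 0 0, B 0 1, B 1 1, m, left_ne_zero_of_mul hB, right_ne_zero_of_mul hB, hm, ?_⟩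
    rwa [← h0, ← Matrix.eta_fin_two B]
  by_cases h0 : A 1 0 = 0
  · exact ⟨C, Iso.refl C, A, l, hA, hl, h0, h⟩
  · obtain ⟨p, hp⟩ := IsAlgClosed.exists_root (Polynomial.C (A 1 0) * X ^ 2 +
      Polynomial.C (A 1 1 - A 0 0) * X + Polynomial.C (-A 0 1)) (by
        rw [degree_quadratic h0]; decide)
    obtain ⟨D, τ, hτ⟩ := C.exists_translation p
    obtain ⟨E, υ, hυ, -⟩ := D.exists_inversion
    have hM := hυ.trans hτ
    have hM0 : (!![1, p; 0, 1] * !![0, 1; 1, 0] : Matrix (Fin 2) (Fin 2) k).det ≠ 0 := by simp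
    refine ⟨E, υ.trans τ, _, _, ?_, ?_, ?_, h.conj hM hM0 (by simp)⟩
    · rw [Matrix.det_mul, Matrix.det_mul, Matrix.det_adjugate]
      exact mul_ne_zero (pow_ne_zero _ hM0) (mul_ne_zero hA hM0)
    · exact mul_ne_zero (pow_ne_zero _ hM0) hl
    · simp [IsRoot] at hp
      rw [Matrix.adjugate_fin_two]
      simp [Matrix.mul_apply, Fin.sum_univ_two]
      linear_combination hp

theorem exists_conj_diagonal (h2 : (2 : k) ≠ 0) (hg : 2 ≤ g) {C : HyperellipticCurve k g}
    (σ : C.Aut) {n : ℕ} (hn : (n : k) ≠ 0)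
    (hσ : σ ^ n ∈ Subgroup.normalClosure {C.hyperellipticInvolution}) :
    ∃ (D : HyperellipticCurve k g) (ρ : D.Iso C) (μ μ' : kˣ),
      IsGenericallyRepresentedBy (ρ.conj σ) !![(μ : k), 0; 0, 1] μ' := by
  obtain ⟨D, ρ, e, h, d, l, he, hd, hl, H⟩ := exists_conj_fixing_infinity h2 hg σ
  -- A finite fixed point of `x ↦ (ex + h)/d`. If `e = d`, triviality of the `n`-th power on `x`
  -- forces `h = 0`, and `p = 0` serves.
  obtain ⟨p, hp⟩ : ∃ p, e * p + h = d * p := by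
    by_cases hed : e = d
    · subst hed
      refine ⟨0, ?_⟩
      rw [← ρ.conj_mem_normalClosure_iff h2 hg, ρ.conj_pow] at hσ
      obtain ⟨m, -, hm⟩ := IsGenericallyRepresentedBy.of_mem_normalClosure h2 hg hσ
      have h3 := ((H.pow n).eq_scalar hm).1
      have h4 := (Matrix.upperTriangular_pow e h n).2
      rw [h3, mul_zero] at h4
      have := (mul_eq_zero.1 h4.symm).resolve_left (mul_ne_zero hn (pow_ne_zero _ he))
      rw [this]
      ring
    · refine ⟨h / (d - e), ?_⟩
      have : d - e ≠ 0 := sub_ne_zero.2 (Ne.symm hed)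
      field_simp
      ring
  obtain ⟨E, τ, hτ⟩ := D.exists_translation p
  have h3 := (H.conj hτ (by simp) one_ne_zero).smul (inv_ne_zero hd)
  refine ⟨E, τ.trans ρ, Units.mk0 (e / d) (div_ne_zero he hd),
    Units.mk0 (d⁻¹ ^ (g + 1) * (Matrix.det !![1, p; 0, 1] ^ (g + 1) * l)) ?_, ?_⟩
  · simp [hd, hl]
  · change IsGenericallyRepresentedBy (τ.conj (ρ.conj σ)) _ _
    convert h3 using 1
    rw [Matrix.adjugate_fin_two_of]
    ext i j
    fin_cases i <;> fin_cases j <;> simp [hd]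
    · field_simp
    · linear_combination hp
    · rfl

/-- Invariance of the curve reads `f(μx) = μ'² f(x)`; compare leading coefficients. -/
theorem sq_eq_pow_natDegree {C : HyperellipticCurve k g} {σ : C.Aut} {μ μ' : kˣ}
    (h : IsRepresentedBy σ (diagOne μ) μ') (n : ℕ) (hn : C.f.natDegree = n) :
    (μ' : k) ^ 2 = μ ^ n := by
  have e : C.f.comp (Polynomial.C (μ : k) * X) = Polynomial.C ((μ' : k) ^ 2) * C.f := by
    have : Infinite k := IsAlgClosed.instInfinite
    refine Polynomial.funext fun x => ?_
    obtain ⟨P, rfl⟩ := AffineDoubleCover.exists_x_eq C.f x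
    obtain ⟨Q, -, hx, hy⟩ := h P (by simp [diagOne])
    simp [diagOne] at hx hy
    rw [eval_comp, eval_mul, eval_mul, eval_C, eval_X, eval_C, ← hx, ← Q.equation, ← P.equation,
      hy, mul_pow]
  have h1 := congrArg (fun p => p.coeff n) e
  simp only [comp_C_mul_X_coeff, coeff_C_mul] at h1
  have h3 : C.f.coeff n ≠ 0 := by
    rw [← hn]
    exact leadingCoeff_ne_zero.2 C.separable.ne_zero
  apply mul_right_cancel₀ h3
  linear_combination -h1

end Rigidity

end HyperellipticCurve

/-! ### The main theorem -/

theorem mainTheorem10 {k : Type*} [Field k] [IsAlgClosed k] (h2 : (2 : k) ≠ 0)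
    (g : ℕ) (hg : 2 ≤ g) (C : HyperellipticCurve k g)
    (ℓ : ℕ) (hℓ : (ℓ : k) ≠ 0) (σ : C.Aut) (hσ : orderOf (σ : C.ReducedAut) = ℓ) :
    (∃ (C' : HyperellipticCurve k g) (ρ : C'.Iso C) (μ μ' : kˣ),
      HyperellipticCurve.IsRepresentedBy ((ρ.trans σ).trans ρ.symm) (diagOne μ) μ' ∧
      IsPrimitiveRoot μ ℓ ∧ (μ' ^ ℓ = 1 ∨ μ' ^ ℓ = -1)) ∧
    (∀ (C' : HyperellipticCurve k g) (ρ : C'.Iso C) (μ μ' : kˣ),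
      HyperellipticCurve.IsRepresentedBy ((ρ.trans σ).trans ρ.symm) (diagOne μ) μ' →
      IsPrimitiveRoot μ ℓ → (μ' ^ ℓ = 1 ∨ μ' ^ ℓ = -1) →
      (C'.f.natDegree = 2 * g + 2 → μ' = μ ^ (g + 1) ∨ μ' = -μ ^ (g + 1)) ∧
      (C'.f.natDegree = 2 * g + 1 →
        ∃ s : kˣ, s ^ 2 = μ ^ (2 * g + 1) ∧ (μ' = s ∨ μ' = -s)) ∧
      (σ = C.hyperellipticInvolution ↔ (μ = 1 ∧ μ' = -1) ∧ ℓ = 1)) := by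
  have hmem : ∀ n : ℕ, σ ^ n ∈ Subgroup.normalClosure {C.hyperellipticInvolution} ↔ ℓ ∣ n := by
    intro n
    rw [← hσ, orderOf_dvd_iff_pow_eq_one, ← QuotientGroup.mk_pow, QuotientGroup.eq_one_iff]
  constructor
  · obtain ⟨D, ρ, μ, μ', h⟩ :=
      HyperellipticCurve.exists_conj_diagonal h2 hg σ hℓ ((hmem ℓ).2 dvd_rfl)
    have hpow : ∀ n : ℕ, (!![(μ : k), 0; 0, 1] ^ n : Matrix (Fin 2) (Fin 2) k) =
        !![(μ : k) ^ n, 0; 0, 1] := by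
      intro n
      induction n with
      | zero => simp [Matrix.one_fin_two]
      | succ n ih => rw [pow_succ, ih]; simp [pow_succ]
    -- For such `n` the conjugate of `σ^n` is represented both by `(diag(μ^n, 1), μ'^n)` and by `(1,
    -- ±1)`.
    have key : ∀ n : ℕ, ℓ ∣ n → μ ^ n = 1 ∧ (μ' ^ n = 1 ∨ μ' ^ n = -1) := by
      intro n hn
      have h3 := (hmem n).2 hn
      rw [← ρ.conj_mem_normalClosure_iff h2 hg, ρ.conj_pow] at h3
      obtain ⟨l, hl, h4⟩ :=
        HyperellipticCurve.IsGenericallyRepresentedBy.of_mem_normalClosure h2 hg h3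
      have h5 := h.pow n
      rw [hpow] at h5
      have h6 : (μ : k) ^ n = 1 := by simpa using (h5.eq_scalar h4).2.2
      refine ⟨Units.ext (by simpa using h6), ?_⟩
      rw [h6, ← Matrix.one_fin_two] at h5
      rw [← h5.scalar_unique h4] at hl
      exact hl.imp (fun h => Units.ext (by simpa using h)) (fun h => Units.ext (by simpa using h))
    refine ⟨D, ρ, μ, μ', HyperellipticCurve.IsGenericallyRepresentedBy.isRepresentedBy h,
      ⟨(key ℓ dvd_rfl).1, fun n hn => ?_⟩, (key ℓ dvd_rfl).2⟩
    rw [← hmem, ← ρ.conj_mem_normalClosure_iff h2 hg, ρ.conj_pow,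
      HyperellipticCurve.mem_normalClosure_iff h2 hg]
    have h3 := h.pow n
    have h4 : (μ : k) ^ n = 1 := by rw [← Units.val_pow_eq_pow_val, hn, Units.val_one]
    rw [hpow, h4, ← Matrix.one_fin_two] at h3
    have h5 := HyperellipticCurve.sq_eq_pow_natDegree
      (HyperellipticCurve.IsGenericallyRepresentedBy.isRepresentedBy (A := diagOne μ) h) _ rfl
    -- Primitivity: if `μ^n = 1`, then `μ'² = μ^(deg f)` gives `μ'^n = ±1`, so `σ^n` is conjugate to
    -- 1 or to the involution and `ℓ ∣ n`.
    have h6 : ((μ' : k) ^ n) ^ 2 = 1 := by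
      rw [pow_right_comm, h5, pow_right_comm, h4, one_pow]
    rcases sq_eq_sq_iff_eq_or_eq_neg.1 (h6.trans (one_pow 2).symm) with h7 | h7
    · rw [h7] at h3
      exact Or.inl h3.eq_one
    · rw [h7] at h3
      exact Or.inr (h3.eq D.isGenericallyRepresentedBy_hyperellipticInvolution (by simp) (by simp))
  · intro D ρ μ μ' h hμ hμ'
    have hgen := HyperellipticCurve.IsGenericallyRepresentedBy.of_isRepresentedBy h
    refine ⟨fun hd => ?_, fun hd => ?_, fun hs => ?_, ?_⟩
    · have h3 := HyperellipticCurve.sq_eq_pow_natDegree h _ hd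
      rw [show 2 * g + 2 = (g + 1) * 2 by ring, pow_mul] at h3
      exact (sq_eq_sq_iff_eq_or_eq_neg.1 h3).imp (fun h => Units.ext (by simpa using h))
        (fun h => Units.ext (by simpa using h))
    · have h3 := HyperellipticCurve.sq_eq_pow_natDegree h _ hd
      -- The scalar `μ'` is itself a square root of `μ^(2g+1)`.
      exact ⟨μ', Units.ext (by simpa using h3), Or.inl rfl⟩
    · have hl : ℓ = 1 := by
        have := (hmem 1).1 (by rw [pow_one, hs]; exact Subgroup.subset_normalClosure rfl)
        exact Nat.dvd_one.1 this
      subst hl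
      have hμ1 : μ = 1 := by simpa using hμ.pow_eq_one
      refine ⟨⟨hμ1, ?_⟩, rfl⟩
      rw [pow_one] at hμ'
      refine hμ'.resolve_left fun h1 => ?_
      rw [hμ1, h1, Units.val_one, ← Matrix.one_fin_two] at hgen
      have h3 : ρ.conj σ = ρ.conj 1 := hgen.eq_one.trans ρ.conj_one.symm
      exact C.hyperellipticInvolution_ne_one h2 (hs.symm.trans (ρ.conj_injective h3))
    · rintro ⟨⟨rfl, rfl⟩, -⟩
      rw [Units.val_one, ← Matrix.one_fin_two, Units.val_neg, Units.val_one] at hgen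
      apply ρ.conj_injective
      rw [ρ.conj_hyperellipticInvolution h2 hg]
      exact hgen.eq D.isGenericallyRepresentedBy_hyperellipticInvolution (by simp) (by simp)
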